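/- Let $D>1$ be a square-free integer, let $\mathcal O_D$ be the ring of integers of $\mathbb Q(\sqrt D)\subset\mathbb R$, and let $\varepsilon>1$ be its fundamental unit (so every unit of $\mathcal O_D$ is $\pm\varepsilon^j$ with $j\in\mathbb Z$). Put $q=D$ if $D\equiv 1 \bmod 4$ and $q=4D$ otherwise. Let $F_D(n)=\operatorname{Tr}_{\mathbb Q(\sqrt D)/\mathbb Q}(\varepsilon^n/\sqrt q)$ and $$Z_D^{\mathrm{even}}(s)=\sum_{n\ge1}\frac1{F_D(2n)^s}=q^{s/2}\sum_{n\ge1}\bigl(\varepsilon^{2n}-\varepsilon^{-2n}\bigr)^{-s}.$$ Let $P=\{\frac{\pi i m}{\log\varepsilon}-2k : m\in\mathbb Z,\ k\in\mathbb Z_{\ge0}\}$. Then: 1. For $\operatorname{Re}s>0$ the two defining series above converge absolutely and are equal, and $Z_D^{\mathrm{even}}(s)$ has a meromorphic continuation to all of $\mathbb C$. 2. For $\operatorname{Re}s<2$ with $s\ne1$ and $s\notin P$, the continuation is given by $$Z_D^{\mathrm{even}}(s)=\frac{q^{s/2}\zeta(s)}{(4\log\varepsilon)^s}+\frac{q^{s/2}\,\Gamma(1-s)\Gamma(\frac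 s2)}{4\,\Gamma(1-\frac s2)\log\varepsilon}+q^{s/2}\sum_{m\ne0}\left(\frac{\Gamma(1-s)\,\Gamma(\frac s2-\frac{\pi i m}{2\log\varepsilon})}{4\,\Gamma(1-\frac s2-\frac{\pi i m}{2\log\varepsilon})\log\varepsilon}-\frac{\Gamma(1-s)\,e^{\frac{\pi i}{2}(1-s)\operatorname{sgn}(m)}}{(2\pi|m|)^{1-s}(4\log\varepsilon)^s}\right),$$ where $m$ runs over the non-zero integers and the sum converges absolutely. 3. For $\operatorname{Re}s<0$ with $s\notin P$, the continuation is also given by the absolutely convergent sum $$Z_D^{\mathrm{even}}(s)=\frac{q^{s/2}\,\Gamma(1-s)}{4\log\varepsilon}\sum_{m\in\mathbb Z}\frac{\Gamma(\frac s2-\frac{\pi i m}{2\log\varepsilon})}{\Gamma(1-\frac s2-\frac{\pi i m}{2\log\varepsilon})}.$$ 4. The continuation has a simple pole at every point of $P$ and is holomorphic at every other point of $\mathbb C$. -/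

import Mathlib

open scoped NumberField IntermediateField

noncomputable section

namespace FibZeta

/-- The real quadratic field `ℚ(√D)`, as a subfield of `ℝ`. -/
abbrev QuadField (D : ℕ) : IntermediateField ℚ ℝ := ℚ⟮√(D : ℝ)⟯

/-- `q = D` if `D ≡ 1 mod 4`, and `q = 4 D` otherwise. -/
def q (D : ℕ) : ℕ := if D % 4 = 1 then D else 4 * D

theorem sqrt_q_mem (D : ℕ) : √(q D : ℝ) ∈ QuadField D := by
  have h : √(D : ℝ) ∈ QuadField D := IntermediateField.mem_adjoin_simple_self ℚ _
  unfold q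
  split_ifs
  · exact h
  · have h2 : √((4 * D : ℕ) : ℝ) = √(D : ℝ) + √(D : ℝ) := by
      push_cast
      rw [Real.sqrt_mul (by norm_num), show (4 : ℝ) = 2 ^ 2 by norm_num,
        Real.sqrt_sq (by norm_num)]
      ring
    rw [h2]
    exact add_mem h h

/-- `√q` as an element of `ℚ(√D)`. -/
def sqrtQ (D : ℕ) : QuadField D := ⟨√(q D : ℝ), sqrt_q_mem D⟩

/-- The real number underlying a unit of the ring of integers of `ℚ(√D) ⊂ ℝ`. -/
def unitToReal {D : ℕ} (u : (𝓞 (QuadField D))ˣ) : ℝ :=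
  (((u : 𝓞 (QuadField D)) : QuadField D) : ℝ)

/-- `ε` is the fundamental unit of the ring of integers of `ℚ(√D)`, normalized by `ε > 1`:
every unit is `± ε ^ j` for some integer `j`. -/
def IsFundamentalUnit {D : ℕ} (ε : (𝓞 (QuadField D))ˣ) : Prop :=
  1 < unitToReal ε ∧ ∀ u : (𝓞 (QuadField D))ˣ, ∃ j : ℤ, u = ε ^ j ∨ u = -ε ^ j

/-- The Fibonacci sequence of `ℚ(√D)`: the trace to `ℚ` of `ε ^ n / √q`. -/
def fib {D : ℕ} (ε : (𝓞 (QuadField D))ˣ) (n : ℕ) : ℚ :=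
  Algebra.trace ℚ (QuadField D) (((ε : 𝓞 (QuadField D)) : QuadField D) ^ n / sqrtQ D)

/-- The half-lattice `π i m / log e - 2 k`, with `m` an integer and `k ≥ 0` an integer. -/
def poleSet (e : ℝ) : Set ℂ :=
  {s | ∃ (m : ℤ) (k : ℕ), s = Real.pi * Complex.I * m / Real.log e - 2 * k}

/-- The quotient `Γ(s/2 - π i m / (2 log e)) / Γ(1 - s/2 - π i m / (2 log e))`. -/
def gammaRatio (e : ℝ) (s : ℂ) (m : ℤ) : ℂ :=
  Complex.Gamma (s / 2 - Real.pi * Complex.I * m / (2 * Real.log e)) /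
    Complex.Gamma (1 - s / 2 - Real.pi * Complex.I * m / (2 * Real.log e))

/-- The `m`-th term, for `m ≠ 0`, of the sum in the expression for `Re s < 2`. -/
def poissonTerm (e : ℝ) (s : ℂ) (m : ℤ) : ℂ :=
  Complex.Gamma (1 - s) * gammaRatio e s m / (4 * Real.log e) -
    Complex.Gamma (1 - s) *
        Complex.exp (Real.pi * Complex.I / 2 * (1 - s) * (m.sign : ℂ)) /
      ((2 * Real.pi * |(m : ℝ)| : ℝ) ^ (1 - s) * (4 * Real.log e : ℝ) ^ s)

end FibZeta

end

namespace FibZeta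

open Filter Topology

/-! ### The coefficients of the binomial series of `(1 - x) ^ (-s)` -/

/-! Put `L = log ε`. A unit has norm `±1`, so conjugation sends `ε ^ (2n)` to `ε ^ (-2n)` and `√q`
to `-√q`; hence `F_D(2n)` is `(e^{2nL} - e^{-2nL}) / √q` (`fib_two_mul`), and apart from `q^{s/2}`
the series is `∑ (e^{2nL} - e^{-2nL})^{-s}`.

Continuation and poles. With `b_k = binCoeff s k`, the binomial series turns each summand into `∑
b_k e^{-2nL(s+2k)}`, and the geometric sum over `n` gives `sinhZeta`, that is `∑ b_k / (e^{2L(s+2k)}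
- 1)` (`hasSum_sinhZeta`). Its terms decay geometrically, locally uniformly in `s`, so it is
meromorphic on the whole plane. The `k`-th term has simple poles on the line `Re s = -2k` only, so
poles of different terms cannot cancel (`meromorphicOrderAt_sinhZeta`).

Half-plane `Re s < 0`. Expand `1 / (e^w - 1)` in partial fractions over the points `2πim` and sum
over `k` first. The constant `-1/2` disappears because `∑ b_k = (1 - 1)^{-s} = 0` (`tsum_binCoeff`),
and `∑ b_k / (k + a)` is the Beta integral `B(a, 1 - s)` (`tsum_binCoeff_div`). This produces the
Gamma quotients (`hasSum_gammaRatio_pair`).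

Half-plane `Re s < 2`. With `y = πm / (2L)`, the `m`-th quotient is `(-iy)^{s-1} + O(|y|^{Re s -
3})` (`norm_Gamma_div_Gamma_sub_le`), so the differences are summable there. For `Re s < 0` the
subtracted terms add up to the zeta term by the functional equation (`Gamma_mul_leading_eq_zeta`),
and the identity theorem extends the formula (`sinhZeta_eq_poissonExpansion`). -/

/-- The coefficient `s (s + 1) ⋯ (s + k - 1) / k!` of `x ^ k` in `(1 - x) ^ (-s)`. -/
noncomputable def binCoeff (s : ℂ) (k : ℕ) : ℂ := Ring.multichoose s k

theorem binCoeff_zero (s : ℂ) : binCoeff s 0 = 1 := Ring.multichoose_zero_right s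

theorem factorial_mul_binCoeff (s : ℂ) (k : ℕ) :
    (k.factorial : ℂ) * binCoeff s k = (ascPochhammer ℂ k).eval s := by
  rw [binCoeff, ← nsmul_eq_mul, Ring.factorial_nsmul_multichoose_eq_ascPochhammer,
    Polynomial.ascPochhammer_smeval_eq_eval]

theorem succ_mul_binCoeff_succ (s : ℂ) (k : ℕ) :
    ((k : ℂ) + 1) * binCoeff s (k + 1) = (s + k) * binCoeff s k := by
  have h := factorial_mul_binCoeff s (k + 1)
  rw [ascPochhammer_succ_eval, ← factorial_mul_binCoeff, Nat.factorial_succ] at h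
  have h0 : (k.factorial : ℂ) ≠ 0 := by exact_mod_cast k.factorial_ne_zero
  apply mul_left_cancel₀ h0
  push_cast at h
  linear_combination h

theorem hasSum_binCoeff_mul_pow (s : ℂ) {x : ℂ} (hx : ‖x‖ < 1) :
    HasSum (fun k => binCoeff s k * x ^ k) ((1 - x) ^ (-s)) := by
  have h := (Complex.one_div_one_sub_cpow_hasFPowerSeriesOnBall_zero s).hasSum
    (y := x) (by simpa [← ofReal_norm] using hx)
  simp only [FormalMultilinearSeries.ofScalars_apply_eq, zero_add, smul_eq_mul] at h
  simpa [binCoeff, Ring.multichoose_eq, Complex.cpow_neg] using h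

/-- By the recurrence and `‖s + k‖ ≤ r + k`. It makes estimates uniform on discs. -/
theorem norm_binCoeff_le {s : ℂ} {r : ℝ} (h : ‖s‖ ≤ r) (k : ℕ) :
    ‖binCoeff s k‖ ≤ ‖binCoeff r k‖ := by
  induction k with
  | zero => simp [binCoeff_zero]
  | succ k ih =>
    have hr : 0 ≤ r := (norm_nonneg s).trans h
    have h1 := congrArg norm (succ_mul_binCoeff_succ s k)
    have h2 := congrArg norm (succ_mul_binCoeff_succ r k)
    rw [norm_mul, norm_mul] at h1 h2
    have h0 : 0 < ‖(k : ℂ) + 1‖ := by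
      rw [norm_pos_iff]; exact_mod_cast k.succ_ne_zero
    have h3 : ‖s + k‖ ≤ ‖(r : ℂ) + k‖ := by
      have e : ‖(r : ℂ) + k‖ = r + k := by
        rw [show (r : ℂ) + k = ((r + k : ℝ) : ℂ) by push_cast; rfl, Complex.norm_real,
          Real.norm_of_nonneg (by positivity)]
      rw [e]
      exact (norm_add_le _ _).trans (by simpa using h)
    refine le_of_mul_le_mul_left ?_ h0
    rw [h1, h2]
    gcongr

theorem summable_norm_binCoeff_mul_pow (s : ℂ) {x : ℝ} (hx0 : 0 ≤ x) (hx : x < 1) :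
    Summable (fun k => ‖binCoeff s k‖ * x ^ k) := by
  have h := (hasSum_binCoeff_mul_pow (‖s‖ : ℂ) (x := x)
    (by rwa [Complex.norm_real, Real.norm_of_nonneg hx0])).summable.norm
  refine h.of_nonneg_of_le (fun k => by positivity) fun k => ?_
  rw [norm_mul, norm_pow, Complex.norm_real, Real.norm_of_nonneg hx0]
  gcongr
  exact norm_binCoeff_le le_rfl k

/-- `‖s + k‖ = k + Re s + O(1/k)`; giving up half of the negative `Re s` absorbs the error. -/
theorem norm_add_natCast_le {s : ℂ} (hs : s.re < 0) :
    ∀ᶠ k : ℕ in atTop, ‖s + k‖ ≤ k + s.re / 2 := by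
  obtain ⟨N, hN⟩ := exists_nat_ge (‖s‖ ^ 2 / (-s.re) - s.re)
  filter_upwards [eventually_ge_atTop N] with k hk
  have hk' : ‖s‖ ^ 2 / (-s.re) - s.re ≤ k := hN.trans (by exact_mod_cast hk)
  have h1 : ‖s‖ ^ 2 / (-s.re) * (-s.re) = ‖s‖ ^ 2 := div_mul_cancel₀ _ (by linarith)
  have h3 : 0 ≤ ‖s‖ ^ 2 / (-s.re) := div_nonneg (by positivity) (by linarith)
  have h2 : ‖s + k‖ ^ 2 = ‖s‖ ^ 2 + 2 * k * s.re + k ^ 2 := by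
    rw [← Complex.normSq_eq_norm_sq, ← Complex.normSq_eq_norm_sq, Complex.normSq_apply,
      Complex.normSq_apply]
    simp
    ring
  refine le_of_sq_le_sq (by rw [h2]; nlinarith [sq_nonneg s.re]) (by linarith)

/-- Raabe's test: the recurrence gives `(k+1)‖b_{k+1}‖ = ‖s+k‖ ‖b_k‖`, so `(-Re s / 2)‖b_k‖` is
eventually at most a telescoping difference of `k‖b_k‖`. -/
theorem summable_norm_binCoeff {s : ℂ} (hs : s.re < 0) : Summable (fun k => ‖binCoeff s k‖) := by
  obtain ⟨N, hN⟩ := eventually_atTop.1 (norm_add_natCast_le hs)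
  set a : ℕ → ℝ := fun k => ‖binCoeff s k‖
  have key : ∀ k ≥ N, (-s.re / 2) * a k ≤ k * a k - (k + 1 : ℕ) * a (k + 1) := by
    intro k hk
    have h1 := congrArg norm (succ_mul_binCoeff_succ s k)
    rw [norm_mul, norm_mul] at h1
    have h2 : ‖(k : ℂ) + 1‖ = ((k + 1 : ℕ) : ℝ) := by
      rw [← Complex.norm_natCast]; push_cast; rfl
    rw [h2] at h1
    have h3 := mul_le_mul_of_nonneg_right (hN k hk) (norm_nonneg (binCoeff s k))
    simp only [a]
    rw [h1]
    linarith
  rw [← summable_nat_add_iff N]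
  refine summable_of_sum_range_le (c := N * a N / (-s.re / 2)) (fun _ => norm_nonneg _) fun n => ?_
  rw [le_div_iff₀ (by linarith), mul_comm, Finset.mul_sum]
  have h : ∀ n, ∑ i ∈ Finset.range n, (-s.re / 2) * a (i + N) ≤
      N * a N - (n + N : ℕ) * a (n + N) := by
    intro n
    induction n with
    | zero => simp
    | succ n ih =>
      rw [Finset.sum_range_succ, show n + 1 + N = n + N + 1 by ring]
      linarith [key (n + N) (by omega)]
  exact (h n).trans (sub_le_self _ (by positivity))

theorem sum_range_binCoeff (s : ℂ) (n : ℕ) :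
    s * ∑ k ∈ Finset.range n, binCoeff s k = n * binCoeff s n := by
  induction n with
  | zero => simp
  | succ n ih =>
    rw [Finset.sum_range_succ, mul_add, ih]
    push_cast
    rw [succ_mul_binCoeff_succ]
    ring

/-- The partial sums are `n b_n / s`. A non-zero limit would force `‖b_n‖ ≥ c / n` eventually,
against absolute summability. -/
theorem tsum_binCoeff {s : ℂ} (hs : s.re < 0) : ∑' k, binCoeff s k = 0 := by
  have hsum := summable_norm_binCoeff hs
  have hs0 : s ≠ 0 := by rintro rfl; simp at hs
  have h1 := hsum.of_norm.hasSum.tendsto_sum_nat.const_mul s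
  simp only [sum_range_binCoeff] at h1
  by_contra hne
  have h2 : 0 < ‖s * ∑' k, binCoeff s k‖ := by
    rw [norm_pos_iff]; exact mul_ne_zero hs0 hne
  set ℓ := ‖s * ∑' k, binCoeff s k‖
  have h3 := h1.norm.eventually (eventually_gt_nhds (half_lt_self h2))
  refine Real.not_summable_one_div_natCast ((Summable.of_norm_bounded_eventually_nat
    (hsum.mul_left (2 / ℓ)) ?_) : Summable fun n : ℕ => 1 / (n : ℝ))
  filter_upwards [h3, eventually_gt_atTop 0] with n hn hn0
  have hn' : (0 : ℝ) < n := by exact_mod_cast hn0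
  replace hn : ℓ / 2 < n * ‖binCoeff s n‖ := by
    rwa [← Complex.norm_natCast, ← norm_mul]
  rw [Real.norm_of_nonneg (by positivity), div_mul_eq_mul_div, div_le_div_iff₀ hn' h2]
  linarith

theorem summable_norm_binCoeff_div {s : ℂ} (hs : s.re < 0) (a : ℂ) :
    Summable (fun k : ℕ => ‖binCoeff s k / (k + a)‖) := by
  refine Summable.of_norm_bounded_eventually_nat (summable_norm_binCoeff hs) ?_
  obtain ⟨N, hN⟩ := exists_nat_ge (1 - a.re)
  filter_upwards [eventually_ge_atTop N] with k hk
  have h1 : 1 ≤ ‖(k : ℂ) + a‖ := by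
    refine le_trans ?_ ((Complex.re_le_norm _))
    have : (N : ℝ) ≤ k := by exact_mod_cast hk
    simp
    linarith
  rw [norm_norm, norm_div]
  exact div_le_self (norm_nonneg _) h1

/-- Two evaluations of `∑ k b_k / (k + a)`: directly, by `k/(k+a) = 1 - a/(k+a)`, and after an index
shift using the recurrence. Both use `∑ b_k = 0`. The Gamma expression satisfies the same relation
in `a`. -/
theorem mul_tsum_binCoeff_div {s : ℂ} (hs : s.re < 0) {a : ℂ} (ha : ∀ k : ℕ, (k : ℂ) + a ≠ 0) :
    a * ∑' k : ℕ, binCoeff s k / (k + a) =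
      (a + 1 - s) * ∑' k : ℕ, binCoeff s k / (k + (a + 1)) := by
  have S0 := (summable_norm_binCoeff hs).of_norm
  have Sa := (summable_norm_binCoeff_div hs a).of_norm
  have Sb := (summable_norm_binCoeff_div hs (a + 1)).of_norm
  have e1 : ∑' k : ℕ, binCoeff s k * k / (k + a) = -(a * ∑' k : ℕ, binCoeff s k / (k + a)) := by
    rw [← tsum_mul_left, ← zero_sub, ← tsum_binCoeff hs, ← S0.tsum_sub (Sa.mul_left a)]
    refine tsum_congr fun k => ?_
    field_simp [ha k]
    ring
  have e2 : ∑' k : ℕ, binCoeff s k * k / (k + a) =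
      -((a + 1 - s) * ∑' k : ℕ, binCoeff s k / (k + (a + 1))) := by
    have Sk : Summable (fun k : ℕ => binCoeff s k * k / (k + a)) := by
      refine (S0.sub (Sa.mul_left a)).congr fun k => ?_
      field_simp [ha k]
      ring
    rw [Sk.tsum_eq_zero_add, ← tsum_mul_left, ← zero_sub, ← tsum_binCoeff hs,
      ← S0.tsum_sub (Sb.mul_left _)]
    simp only [Nat.cast_zero, mul_zero, zero_div, zero_add]
    refine tsum_congr fun k => ?_
    have h1 := succ_mul_binCoeff_succ s k
    have h2 := ha (k + 1)
    push_cast at h2 ⊢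
    have h3 : (k : ℂ) + (a + 1) ≠ 0 := by convert h2 using 1; ring
    rw [mul_comm (binCoeff s (k + 1)), h1]
    field_simp
    ring
  rw [← neg_inj, ← e1, e2]

/-- Integrate the binomial series of `x^{a-1} (1-x)^{-s}` term by term over `[0,1]`; summability of
`‖b_k‖` supplies the majorant. -/
theorem tsum_binCoeff_div_of_re_pos {s a : ℂ} (hs : s.re < 0) (ha : 0 < a.re) :
    ∑' k : ℕ, binCoeff s k / (k + a) =
      Complex.Gamma (1 - s) * Complex.Gamma a / Complex.Gamma (a + 1 - s) := by
  have hs1 : 0 < (1 - s).re := by simp; linarith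
  have hg : Complex.Gamma (a + 1 - s) ≠ 0 :=
    Complex.Gamma_ne_zero_of_re_pos (by simp at hs1 ⊢; linarith)
  rw [eq_div_iff hg, mul_comm (Complex.Gamma (1 - s)),
    Complex.Gamma_mul_Gamma_eq_betaIntegral ha hs1, mul_comm, add_sub_assoc]
  congr 1
  have hint : ∀ k : ℕ, ∫ x : ℝ in 0..1, (x : ℂ) ^ (a - 1 + k) * binCoeff s k =
      binCoeff s k / (k + a) := by
    intro k
    rw [intervalIntegral.integral_mul_const, integral_cpow (Or.inl (by simp; linarith))]
    have h0 : a - 1 + k + 1 ≠ 0 := by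
      intro h
      have := congrArg Complex.re h
      simp at this
      linarith [Nat.cast_nonneg (α := ℝ) k]
    rw [show (k : ℂ) + a = a - 1 + k + 1 by ring]
    simp [Complex.zero_cpow h0]
    ring
  simp_rw [← hint]
  rw [Complex.betaIntegral]
  refine (intervalIntegral.hasSum_integral_of_dominated_convergence
    (fun k x => x ^ (a.re - 1) * ‖binCoeff s k‖) (fun k => ?_) (fun k => ?_) ?_ ?_ ?_).tsum_eq
  · exact ((Complex.measurable_ofReal.pow_const _).mul_const _).aestronglyMeasurable
  · refine Filter.Eventually.of_forall fun x hx => ?_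
    rw [Set.uIoc_of_le zero_le_one] at hx
    rw [norm_mul, Complex.norm_cpow_eq_rpow_re_of_pos hx.1]
    refine mul_le_mul_of_nonneg_right ?_ (norm_nonneg _)
    refine Real.rpow_le_rpow_of_exponent_ge hx.1 hx.2 ?_
    rw [Complex.add_re, Complex.sub_re, Complex.one_re, Complex.natCast_re]
    linarith [Nat.cast_nonneg (α := ℝ) k]
  · exact Filter.Eventually.of_forall fun x hx => (summable_norm_binCoeff hs).mul_left _
  · simp_rw [tsum_mul_left]
    exact (intervalIntegral.intervalIntegrable_rpow' (by linarith)).mul_const _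
  -- The binomial series needs `|x| < 1`, so the endpoint is discarded as a null set.
  · have h1 : ∀ᵐ x : ℝ, x ≠ 1 := MeasureTheory.Measure.ae_ne _ _
    filter_upwards [h1] with x hx1 hx
    rw [Set.uIoc_of_le zero_le_one] at hx
    have hx0 : (x : ℂ) ≠ 0 := by exact_mod_cast hx.1.ne'
    have h := (hasSum_binCoeff_mul_pow s (x := x) (by
      rw [Complex.norm_real, Real.norm_of_nonneg hx.1.le]
      exact lt_of_le_of_ne hx.2 hx1)).mul_left ((x : ℂ) ^ (a - 1))
    rw [show 1 - s - 1 = -s by ring]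
    refine h.congr_fun ?_
    intro k
    rw [Complex.cpow_add _ _ hx0, Complex.cpow_natCast]
    ring

theorem tsum_binCoeff_div {s a : ℂ} (hs : s.re < 0) (ha : ∀ k : ℕ, (k : ℂ) + a ≠ 0)
    (has : ∀ k : ℕ, (k : ℂ) + (a + 1 - s) ≠ 0) :
    ∑' k : ℕ, binCoeff s k / (k + a) =
      Complex.Gamma (1 - s) * Complex.Gamma a / Complex.Gamma (a + 1 - s) := by
  obtain ⟨n, hn⟩ := exists_nat_gt (-a.re)
  have hpos : 0 < a.re + n := by linarith
  clear hn
  induction n generalizing a with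
  | zero => exact tsum_binCoeff_div_of_re_pos hs (by simpa using hpos)
  | succ n ih =>
    have h1 := mul_tsum_binCoeff_div hs ha
    have a0 : a ≠ 0 := by simpa using ha 0
    have b0 : a + 1 - s ≠ 0 := by simpa using has 0
    have hg : Complex.Gamma (a + 1 - s) ≠ 0 :=
      Complex.Gamma_ne_zero fun m h => has m (by rw [h]; ring)
    rw [ih (a := a + 1) (fun k => by have := ha (k + 1); push_cast at this; convert this using 1; ring)
      (fun k => by have := has (k + 1); push_cast at this; convert this using 1; ring)
      (by push_cast at hpos; simp; linarith), Complex.Gamma_add_one _ a0,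
      show a + 1 + 1 - s = a + 1 - s + 1 by ring, Complex.Gamma_add_one _ b0] at h1
    apply mul_left_cancel₀ a0
    rw [h1]
    field_simp

/-! ### The quotient of two values of `Γ` high up on a vertical line -/

/-- The expression is odd in `x`, so the quadratic Taylor terms cancel and the error is cubic. -/
theorem norm_log_one_sub_sub_log_one_add {x : ℂ} (hx : ‖x‖ ≤ 1 / 2) :
    ‖Complex.log (1 - x) - Complex.log (1 + x) + 2 * x‖ ≤ 2 * ‖x‖ ^ 3 := by
  have taylor : ∀ z : ℂ, ‖z‖ ≤ 1 / 2 →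
      ‖Complex.log (1 + z) - (z - z ^ 2 / 2)‖ ≤ ‖z‖ ^ 3 := by
    intro z hz
    have h := Complex.norm_log_sub_logTaylor_le 2 (z := z) (by linarith)
    have e : Complex.logTaylor (2 + 1) z = z - z ^ 2 / 2 := by
      simp [Complex.logTaylor, Finset.sum_range_succ]
      ring
    rw [e] at h
    refine h.trans ?_
    have h2 : (1 - ‖z‖)⁻¹ ≤ 2 := by
      rw [inv_le_comm₀ (by linarith) (by norm_num)]
      linarith
    have h3 : 0 ≤ ‖z‖ ^ 3 := by positivity
    norm_num
    nlinarith
  have h1 := taylor x hx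
  have h2 := taylor (-x) (by simpa using hx)
  rw [norm_neg] at h2
  have e : Complex.log (1 - x) - Complex.log (1 + x) + 2 * x =
      (Complex.log (1 + -x) - (-x - (-x) ^ 2 / 2)) -
        (Complex.log (1 + x) - (x - x ^ 2 / 2)) := by
    rw [← sub_eq_add_neg]; ring
  rw [e]
  exact (norm_sub_le _ _).trans (by linarith)

/-- The error made in replacing `log ((w - h) / (w + h))` by
`2 * h * log ((w - 1 / 2) / (w + 1 / 2))`. -/
noncomputable def logError (h w : ℂ) : ℂ :=
  (Complex.log (1 - h / w) - Complex.log (1 + h / w)) -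
    2 * h * (Complex.log (1 - 1 / (2 * w)) - Complex.log (1 + 1 / (2 * w)))

/-- Both parts of `logError` have leading term `-2h/w`, which cancels and leaves the cubic
remainders. -/
theorem norm_logError_le {h w : ℂ} {H : ℝ} (hH : ‖h‖ ≤ H) (hw : 1 ≤ ‖w‖) (hw' : 2 * H ≤ ‖w‖) :
    ‖logError h w‖ ≤ (2 * H ^ 3 + H / 2) / ‖w‖ ^ 3 := by
  have w0 : 0 < ‖w‖ := by linarith
  have w0' : w ≠ 0 := norm_pos_iff.1 w0
  have H0 : 0 ≤ H := (norm_nonneg h).trans hH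
  have nv : ‖h / w‖ ≤ H / ‖w‖ := by rw [norm_div]; gcongr
  have nu : ‖1 / (2 * w)‖ = 1 / (2 * ‖w‖) := by simp
  have h1 := norm_log_one_sub_sub_log_one_add (x := h / w) (nv.trans (by
    rw [div_le_div_iff₀ w0 two_pos]; linarith))
  have h2 := norm_log_one_sub_sub_log_one_add (x := 1 / (2 * w)) (by
    rw [nu, div_le_div_iff₀ (by linarith) two_pos]; linarith)
  have e : logError h w =
      (Complex.log (1 - h / w) - Complex.log (1 + h / w) + 2 * (h / w)) -
        2 * h * (Complex.log (1 - 1 / (2 * w)) - Complex.log (1 + 1 / (2 * w)) +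
          2 * (1 / (2 * w))) := by
    rw [logError]
    field_simp
    ring
  rw [e]
  calc _ ≤ 2 * (H / ‖w‖) ^ 3 + 2 * H * (2 * (1 / (2 * ‖w‖)) ^ 3) := by
        refine (norm_sub_le _ _).trans (add_le_add (h1.trans (by gcongr)) ?_)
        rw [norm_mul, norm_mul, Complex.norm_two]
        gcongr
        rw [← nu]
        exact h2
    _ = _ := by field_simp

/-- Both factors lie in the right half-plane, so their arguments add without crossing the branch
cut. -/
theorem log_mul_one_add {w u : ℂ} (hw : 0 < w.re) (hu : ‖u‖ < 1) :
    Complex.log (w * (1 + u)) = Complex.log w + Complex.log (1 + u) := by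
  have h1 : 0 < (1 + u).re := by
    have := (abs_le.1 (Complex.abs_re_le_norm u)).1
    simp
    linarith
  have a1 := abs_lt.1 (Complex.abs_arg_lt_pi_div_two_iff.2 (Or.inl hw))
  have a2 := abs_lt.1 (Complex.abs_arg_lt_pi_div_two_iff.2 (Or.inl h1))
  refine (Complex.log_mul_eq_add_log_iff ?_ ?_).2 ⟨by linarith, by linarith⟩
  · rintro rfl; simp at hw
  · intro h; rw [h] at h1; simp at h1

theorem div_eq_exp_logError {h w : ℂ} (hw : 0 < w.re) (hw1 : 1 ≤ ‖w‖) (hw2 : 2 * ‖h‖ ≤ ‖w‖) :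
    (w - h) / (w + h) = Complex.exp (logError h w +
      2 * h * (Complex.log (w - 1 / 2) - Complex.log (w + 1 / 2))) := by
  have w0 : 0 < ‖w‖ := by linarith
  have w0' : w ≠ 0 := norm_pos_iff.1 w0
  have nv : ‖h / w‖ < 1 := by
    rw [norm_div, div_lt_one w0]
    rcases (norm_nonneg h).eq_or_lt with h0 | h0 <;> linarith
  have nu : ‖1 / (2 * w)‖ < 1 := by
    have : ‖1 / (2 * w)‖ = 1 / (2 * ‖w‖) := by simp
    rw [this, div_lt_one (by linarith)]
    linarith
  have e1 : w - 1 / 2 = w * (1 + -(1 / (2 * w))) := by field_simp; ring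
  have e2 : w + 1 / 2 = w * (1 + 1 / (2 * w)) := by field_simp
  have ne : ∀ u : ℂ, ‖u‖ < 1 → 1 + u ≠ 0 := by
    intro u hu h
    rw [eq_neg_of_add_eq_zero_right h] at hu
    simp at hu
  have n1 := ne _ nv
  have n2 := ne (-(h / w)) (by rwa [norm_neg])
  rw [e1, e2, log_mul_one_add hw nu, log_mul_one_add hw (by rwa [norm_neg]), logError,
    show Complex.log (1 - h / w) - Complex.log (1 + h / w) -
      2 * h * (Complex.log (1 - 1 / (2 * w)) - Complex.log (1 + 1 / (2 * w))) +
      2 * h * (Complex.log w + Complex.log (1 + -(1 / (2 * w))) -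
        (Complex.log w + Complex.log (1 + 1 / (2 * w)))) =
      Complex.log (1 + -(h / w)) - Complex.log (1 + h / w) by
        rw [← sub_eq_add_neg, ← sub_eq_add_neg]; ring,
    Complex.exp_sub, Complex.exp_log n1, Complex.exp_log n2]
  field_simp
  ring

/-- At `w = 1/2 - iy + j` the points `w ∓ 1/2` are `j - iy` and `j + 1 - iy`, so the comparison
logarithms telescope. -/
theorem prod_div_eq_exp {h : ℂ} {y : ℝ} (hy : 1 ≤ |y|) (hy2 : 2 * ‖h‖ ≤ |y|) (n : ℕ) :
    ∏ j ∈ Finset.range n, ((1 / 2 - Complex.I * y + j - h) / (1 / 2 - Complex.I * y + j + h)) =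
      Complex.exp (∑ j ∈ Finset.range n, logError h (1 / 2 - Complex.I * y + j) +
        2 * h * (Complex.log (-Complex.I * y) - Complex.log (n - Complex.I * y))) := by
  induction n with
  | zero => simp
  | succ n ih =>
    have hn : |y| ≤ ‖1 / 2 - Complex.I * y + n‖ := by
      refine le_trans (le_of_eq ?_) (Complex.abs_im_le_norm _)
      simp
    rw [Finset.prod_range_succ, ih, Finset.sum_range_succ,
      div_eq_exp_logError (by simp; positivity) (hy.trans hn) (hy2.trans hn), ← Complex.exp_add]
    congr 1
    rw [show 1 / 2 - Complex.I * y + n - 1 / 2 = n - Complex.I * y by ring,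
      show 1 / 2 - Complex.I * y + n + 1 / 2 = ((n + 1 : ℕ) : ℂ) - Complex.I * y by
        push_cast; ring]
    ring

/-- The majorant telescopes, with total `4 / y ^ 2`. -/
theorem inv_norm_pow_three_le {y : ℝ} (hy : 1 ≤ |y|) (j : ℕ) :
    1 / ‖1 / 2 - Complex.I * y + j‖ ^ 3 ≤ 4 * (1 / (j + |y|) ^ 2 - 1 / ((j + 1 : ℕ) + |y|) ^ 2) := by
  set a : ℝ := j + |y|
  have ha : 0 < a := by positivity
  -- The norm is at least the mean of `|Re|` and `|Im|`.
  have h1 : (a + 1 / 2) / 2 ≤ ‖1 / 2 - Complex.I * y + j‖ := by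
    have e1 := Complex.abs_re_le_norm (1 / 2 - Complex.I * y + j)
    have e2 := Complex.abs_im_le_norm (1 / 2 - Complex.I * y + j)
    have e3 : |(1 / 2 - Complex.I * y + j : ℂ).re| = 1 / 2 + j := by
      simp [abs_of_nonneg (by positivity : (0 : ℝ) ≤ 2⁻¹ + j)]
    have e4 : |(1 / 2 - Complex.I * y + j : ℂ).im| = |y| := by simp
    simp only [a]
    linarith
  have e : ((j + 1 : ℕ) : ℝ) + |y| = a + 1 := by simp only [a]; push_cast; ring
  rw [e]
  calc 1 / ‖1 / 2 - Complex.I * y + j‖ ^ 3 ≤ 1 / ((a + 1 / 2) / 2) ^ 3 := by gcongr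
    _ ≤ 4 * (1 / a ^ 2 - 1 / (a + 1) ^ 2) := by
      rw [div_sub_div _ _ (by positivity) (by positivity), ← mul_div_assoc,
        div_le_div_iff₀ (by positivity) (by positivity)]
      nlinarith [mul_pos ha ha, mul_pos ha (mul_pos ha ha), mul_pos (mul_pos ha ha) (mul_pos ha ha)]

theorem hasSum_one_div_sq_sub {y : ℝ} (hy : 1 ≤ |y|) :
    HasSum (fun j : ℕ => 4 * (1 / (j + |y|) ^ 2 - 1 / ((j + 1 : ℕ) + |y|) ^ 2)) (4 / y ^ 2) := by
  have h : Tendsto (fun n : ℕ => 1 / ((n : ℝ) + |y|) ^ 2) atTop (𝓝 0) := by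
    refine Tendsto.div_atTop tendsto_const_nhds ?_
    exact (tendsto_pow_atTop two_ne_zero).comp
      (tendsto_atTop_add_const_right _ _ tendsto_natCast_atTop_atTop)
  rw [hasSum_iff_tendsto_nat_of_nonneg]
  · simp_rw [← Finset.mul_sum, Finset.sum_range_sub' (fun n : ℕ => 1 / ((n : ℝ) + |y|) ^ 2)]
    have h1 := (h.const_sub (1 / (((0 : ℕ) : ℝ) + |y|) ^ 2)).const_mul 4
    convert h1 using 2
    rw [sub_zero, mul_one_div, Nat.cast_zero, zero_add, sq_abs]
  · exact fun j => le_trans (by positivity) (inv_norm_pow_three_le hy j)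

theorem norm_logError_half_sub_le {h : ℂ} {H : ℝ} (hH : ‖h‖ ≤ H) {y : ℝ} (hy : 1 ≤ |y|)
    (hy2 : 2 * H ≤ |y|) (j : ℕ) :
    ‖logError h (1 / 2 - Complex.I * y + j)‖ ≤ (2 * H ^ 3 + H / 2) *
      (4 * (1 / (j + |y|) ^ 2 - 1 / ((j + 1 : ℕ) + |y|) ^ 2)) := by
  have hn : |y| ≤ ‖1 / 2 - Complex.I * y + j‖ :=
    le_trans (le_of_eq (by simp)) (Complex.abs_im_le_norm _)
  have H0 : 0 ≤ H := (norm_nonneg h).trans hH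
  refine (norm_logError_le hH (hy.trans hn) (hy2.trans hn)).trans ?_
  rw [div_eq_mul_one_div]
  exact mul_le_mul_of_nonneg_left (inv_norm_pow_three_le hy j) (by positivity)

/-- Divide Euler's limit formulas for the two values: the quotient is the limit of `n^{2h}` times
the product in `prod_div_eq_exp`. -/
theorem Gamma_div_Gamma_eq {h : ℂ} {y : ℝ} (hy : 1 ≤ |y|) (hy2 : 2 * ‖h‖ ≤ |y|) :
    Complex.Gamma (1 / 2 - Complex.I * y + h) / Complex.Gamma (1 / 2 - Complex.I * y - h) =
      Complex.exp (2 * h * Complex.log (-Complex.I * y)) *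
        Complex.exp (∑' j : ℕ, logError h (1 / 2 - Complex.I * y + j)) := by
  set z : ℂ := 1 / 2 - Complex.I * y
  have hne : Complex.Gamma (z - h) ≠ 0 := by
    refine Complex.Gamma_ne_zero fun m hm => ?_
    have h1 : -y - h.im = 0 := by simpa [z] using congrArg Complex.im hm
    have h2 := Complex.abs_im_le_norm h
    rw [show h.im = -y by linarith, abs_neg] at h2
    linarith
  have lim1 := (Complex.GammaSeq_tendsto_Gamma (z + h)).div
    (Complex.GammaSeq_tendsto_Gamma (z - h)) hne
  -- Euler's product has `n + 1` factors, so `log n` meets the telescoped end term `log (n + 1 -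
  -- iy)`.
  have hlog : Tendsto (fun n : ℕ => Complex.log n - Complex.log ((n + 1 : ℕ) - Complex.I * y))
      atTop (𝓝 0) := by
    have h1 : Tendsto (fun n : ℕ => 1 + (1 - Complex.I * y) / n) atTop (𝓝 (1 + 0)) :=
      tendsto_const_nhds.add (tendsto_const_div_atTop_nhds_zero_nat _)
    have h2 := (h1.clog (by simp)).neg
    simp only [add_zero, Complex.log_one, neg_zero] at h2
    refine h2.congr' ?_
    filter_upwards [eventually_gt_atTop 0] with n hn
    have hn0 : (n : ℂ) ≠ 0 := by exact_mod_cast hn.ne'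
    have e : ((n + 1 : ℕ) : ℂ) - Complex.I * y =
        ((n : ℝ) : ℂ) * (1 + (1 - Complex.I * y) / n) := by
      push_cast; field_simp; ring
    have hne : 1 + (1 - Complex.I * y) / n ≠ 0 := by
      intro h0
      rw [h0, mul_zero] at e
      have := congrArg Complex.re e
      simp at this
      linarith [Nat.cast_nonneg (α := ℝ) n]
    rw [e, Complex.log_ofReal_mul (by exact_mod_cast hn) hne, Complex.natCast_log]
    ring
  have hsum : Summable fun j : ℕ => logError h (z + j) :=
    .of_norm_bounded ((hasSum_one_div_sq_sub hy).summable.mul_left _)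
      (norm_logError_half_sub_le le_rfl hy hy2)
  have lim2 := ((hlog.const_mul (2 * h)).const_add (2 * h * Complex.log (-Complex.I * y))).add
    (hsum.hasSum.tendsto_sum_nat.comp (tendsto_add_atTop_nat 1))
  rw [mul_zero, add_zero] at lim2
  rw [← Complex.exp_add]
  refine tendsto_nhds_unique lim1 (lim2.cexp.congr' ?_)
  filter_upwards [eventually_gt_atTop 0] with n hn
  have hn0 : (n : ℂ) ≠ 0 := by exact_mod_cast hn.ne'
  have hp := prod_div_eq_exp hy hy2 (n + 1)
  rw [Finset.prod_div_distrib] at hp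
  have hf : (n.factorial : ℂ) ≠ 0 := by exact_mod_cast n.factorial_ne_zero
  have hpow : (n : ℂ) ^ (z + h) = (n : ℂ) ^ (z - h) * Complex.exp (2 * h * Complex.log n) := by
    rw [Complex.cpow_def_of_ne_zero hn0, Complex.cpow_def_of_ne_zero hn0, ← Complex.exp_add]
    congr 1; ring
  have hpow0 : (n : ℂ) ^ (z - h) ≠ 0 := by simp [Complex.cpow_eq_zero_iff, hn0]
  simp only [Function.comp, Pi.div_apply, Complex.GammaSeq]
  rw [hpow,
    show ∏ j ∈ Finset.range (n + 1), (z - h + j) = ∏ j ∈ Finset.range (n + 1), (z + j - h) from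
      Finset.prod_congr rfl fun _ _ => by ring,
    show ∏ j ∈ Finset.range (n + 1), (z + h + j) = ∏ j ∈ Finset.range (n + 1), (z + j + h) from
      Finset.prod_congr rfl fun _ _ => by ring]
  set P := ∏ j ∈ Finset.range (n + 1), (z + j - h)
  set Q := ∏ j ∈ Finset.range (n + 1), (z + j + h)
  calc _ = Complex.exp (2 * h * Complex.log n) * (P / Q) := by
        rw [hp, ← Complex.exp_add]
        congr 1
        ring
    _ = _ := by
        rw [div_div_div_eq]
        field_simp

theorem norm_Gamma_div_Gamma_sub_le (R : ℝ) :
    ∃ C Y : ℝ, ∀ s : ℂ, ‖s‖ ≤ R → ∀ y : ℝ, Y ≤ |y| →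
      ‖Complex.Gamma (s / 2 - Complex.I * y) / Complex.Gamma (1 - s / 2 - Complex.I * y) -
        Complex.exp ((s - 1) * Complex.log (-Complex.I * y))‖ ≤ C * |y| ^ (s.re - 3) := by
  set H : ℝ := (|R| + 1) / 2
  have H0 : 0 < H := by positivity
  set K : ℝ := 2 * H ^ 3 + H / 2
  have K0 : 0 < K := by positivity
  -- `1 + 2H` makes the quotient formula applicable, and `4K` forces `‖E‖ ≤ 1`, so that `‖exp E - 1‖
  -- ≤ 2‖E‖ ≤ 8K / y ^ 2`. The factor `exp (Rπ)` bounds the contribution of the argument of `-iy`.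
  refine ⟨Real.exp (R * Real.pi) * (8 * K), 1 + 2 * H + 4 * K, fun s hs y hy => ?_⟩
  have hy1 : 1 ≤ |y| := by linarith
  have hR : 0 ≤ R := (norm_nonneg s).trans hs
  set h : ℂ := (s - 1) / 2
  have hh : ‖h‖ ≤ H := by
    simp only [h, H, norm_div, Complex.norm_two]
    gcongr
    exact (norm_sub_le _ _).trans (by rw [norm_one, abs_of_nonneg hR]; linarith)
  have key := Gamma_div_Gamma_eq (h := h) hy1 (by linarith)
  rw [show 1 / 2 - Complex.I * y + h = s / 2 - Complex.I * y by simp only [h]; ring,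
    show 1 / 2 - Complex.I * y - h = 1 - s / 2 - Complex.I * y by simp only [h]; ring,
    show 2 * h = s - 1 by simp only [h]; ring] at key
  set E : ℂ := ∑' j : ℕ, logError h (1 / 2 - Complex.I * y + j)
  have hE : ‖E‖ ≤ K * (4 / y ^ 2) :=
    tsum_of_norm_bounded ((hasSum_one_div_sq_sub hy1).mul_left K)
      (norm_logError_half_sub_le hh hy1 (by linarith))
  have hy2 : 1 ≤ y ^ 2 := by rw [← sq_abs]; nlinarith
  have hE1 : ‖E‖ ≤ 1 := by
    refine hE.trans ?_
    rw [← mul_div_assoc, div_le_one (by linarith), ← sq_abs]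
    nlinarith
  have hexp : ‖Complex.exp ((s - 1) * Complex.log (-Complex.I * y))‖ ≤
      Real.exp (R * Real.pi) * |y| ^ (s.re - 1) := by
    rw [Complex.norm_exp, Real.rpow_def_of_pos (by linarith), ← Real.exp_add]
    gcongr
    have e : (Complex.log (-Complex.I * y)).re = Real.log |y| := by
      rw [Complex.log_re]; simp
    rw [Complex.mul_re, e]
    have h1 : |(s - 1).im * (Complex.log (-Complex.I * y)).im| ≤ R * Real.pi := by
      rw [abs_mul]
      gcongr
      · refine le_trans ?_ ((Complex.abs_im_le_norm s).trans hs)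
        simp
      · rw [Complex.log_im]
        exact Complex.abs_arg_le_pi _
    have h2 := neg_abs_le ((s - 1).im * (Complex.log (-Complex.I * y)).im)
    simp only [Complex.sub_re, Complex.one_re]
    linarith [mul_comm (s.re - 1) (Real.log |y|)]
  rw [key, ← mul_sub_one, norm_mul]
  calc _ ≤ Real.exp (R * Real.pi) * |y| ^ (s.re - 1) * (2 * (K * (4 / y ^ 2))) := by
        gcongr
        exact (Complex.norm_exp_sub_one_le hE1).trans (by gcongr)
    _ = _ := by
      rw [show s.re - 3 = s.re - 1 - (2 : ℕ) by push_cast; ring,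
        Real.rpow_sub_natCast (by linarith), sq_abs]
      ring

/-! ### Series of meromorphic functions -/

/-- The finite set `T` collects the terms that may be singular; the others converge normally to a
holomorphic function. -/
theorem exists_analyticAt_tsum_eq {ι : Type*} {f : ι → ℂ → ℂ} {U : Set ℂ} {s₀ : ℂ} {u : ι → ℝ}
    (T : Finset ι) (hU : IsOpen U) (hs₀ : s₀ ∈ U) (hu : Summable u)
    (hd : ∀ i ∉ T, DifferentiableOn ℂ (f i) U) (hb : ∀ i ∉ T, ∀ s ∈ U, ‖f i s‖ ≤ u i) :
    ∃ g : ℂ → ℂ, AnalyticAt ℂ g s₀ ∧ ∀ s ∈ U,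
      Summable (fun i => f i s) ∧ ∑' i, f i s = ∑ i ∈ T, f i s + g s := by
  refine ⟨fun s => ∑' i : {i // i ∉ T}, f i s, ?_, fun s hs => ?_⟩
  · refine DifferentiableOn.analyticAt (s := U) ?_ (hU.mem_nhds hs₀)
    exact Complex.differentiableOn_tsum_of_summable_norm (hu.subtype _)
      (fun i => hd i i.2) hU (fun i s hs => hb i i.2 s hs)
  · have hsum : Summable (fun i => f i s) := by
      refine hu.of_norm_bounded_eventually ?_
      refine (Finset.finite_toSet T).subset fun i hi => ?_
      by_contra hiT
      exact hi (hb i hiT s hs)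
    exact ⟨hsum, (hsum.sum_add_tsum_compl (s := T)).symm⟩

theorem differentiable_binCoeff (k : ℕ) : Differentiable ℂ fun s => binCoeff s k := by
  induction k with
  | zero => simp [binCoeff_zero]
  | succ k ih =>
    have e : (fun s => binCoeff s (k + 1)) = fun s => (s + k) * binCoeff s k / ((k : ℂ) + 1) := by
      funext s
      rw [← succ_mul_binCoeff_succ, mul_div_cancel_left₀ _ (by exact_mod_cast k.succ_ne_zero)]
    rw [e]
    fun_prop

theorem binCoeff_ne_zero {s : ℂ} {k : ℕ} (h : ∀ j < k, s + j ≠ 0) : binCoeff s k ≠ 0 := by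
  induction k with
  | zero => simp [binCoeff_zero]
  | succ k ih =>
    intro h0
    have h1 := succ_mul_binCoeff_succ s k
    rw [h0, mul_zero] at h1
    exact mul_ne_zero (h k k.lt_succ_self) (ih fun j hj => h j (hj.trans k.lt_succ_self)) h1.symm

/-! ### The meromorphic continuation -/

/-- The `k`-th term of the expansion of `∑ n, (2 * sinh (2 * n * L)) ^ (-s)` obtained from the
binomial series. -/
noncomputable def sinhTerm (L : ℝ) (k : ℕ) (s : ℂ) : ℂ :=
  binCoeff s k / (Complex.exp (2 * L * (s + 2 * k)) - 1)

/-- The meromorphic continuation of `∑ n ≥ 1, (2 * sinh (2 * n * L)) ^ (-s)`. -/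
noncomputable def sinhZeta (L : ℝ) (s : ℂ) : ℂ := ∑' k, sinhTerm L k s

theorem exp_eq_one_iff_eq_sub {L : ℝ} (hL : 0 < L) {s : ℂ} {k : ℕ} :
    Complex.exp (2 * L * (s + 2 * k)) = 1 ↔
      ∃ m : ℤ, s = Real.pi * Complex.I * m / L - 2 * k := by
  have hL' : (L : ℂ) ≠ 0 := by exact_mod_cast hL.ne'
  rw [Complex.exp_eq_one_iff]
  refine exists_congr fun m => ?_
  rw [eq_sub_iff_add_eq, eq_div_iff hL']
  constructor <;> intro h
  · linear_combination h / 2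
  · linear_combination 2 * h

/-- For `k ≥ ‖s₀‖ + 1` one has `Re (s + 2k) ≥ k` on the unit ball, so the tail is dominated by the
binomial series of parameter `‖s₀‖ + 1` at `x = e^{-2L}`. -/
theorem exists_tail_bound_sinhTerm {L : ℝ} (hL : 0 < L) (s₀ : ℂ) :
    ∃ N : ℕ, ∃ u : ℕ → ℝ, Summable u ∧ ∀ k ≥ N, ∀ s ∈ Metric.ball s₀ 1,
      Complex.exp (2 * L * (s + 2 * k)) ≠ 1 ∧ ‖sinhTerm L k s‖ ≤ u k := by
  obtain ⟨N, hN⟩ := exists_nat_ge (‖s₀‖ + 1)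
  set x : ℝ := Real.exp (-(2 * L))
  have hx0 : 0 < x := Real.exp_pos _
  have hx1 : x < 1 := by simpa [x] using hL
  refine ⟨N, fun k => ‖binCoeff ((‖s₀‖ + 1 : ℝ) : ℂ) k‖ * x ^ k / (1 - x),
    (summable_norm_binCoeff_mul_pow _ hx0.le hx1).div_const _, fun k hk s hs => ?_⟩
  have hk' : ‖s₀‖ + 1 ≤ k := hN.trans (by exact_mod_cast hk)
  have hk1 : 1 ≤ k := by
    have : (1 : ℝ) ≤ k := by linarith [norm_nonneg s₀]
    exact_mod_cast this
  have hs1 : ‖s‖ ≤ ‖s₀‖ + 1 := by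
    have h1 := norm_le_norm_add_norm_sub' s s₀
    rw [Metric.mem_ball, dist_eq_norm] at hs
    linarith
  have hre : (k : ℝ) ≤ (s + 2 * k).re := by
    have h1 := (abs_le.1 (Complex.abs_re_le_norm s)).1
    simp
    linarith
  have hexp : (x ^ k)⁻¹ ≤ ‖Complex.exp (2 * L * (s + 2 * k))‖ := by
    rw [Complex.norm_exp, ← Real.exp_nat_mul, ← Real.exp_neg,
      show ((2 * L : ℂ) * (s + 2 * k)).re = 2 * L * (s + 2 * k).re by
        rw [← Complex.ofReal_ofNat, ← Complex.ofReal_mul, Complex.re_ofReal_mul]]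
    gcongr
    nlinarith
  have hxk : x ^ k ≤ x := pow_le_of_le_one hx0.le hx1.le (by omega)
  have hpos : 0 < x ^ k := by positivity
  have hd : (1 - x) / x ^ k ≤ ‖Complex.exp (2 * L * (s + 2 * k)) - 1‖ := by
    have h1 := norm_sub_norm_le (Complex.exp (2 * L * (s + 2 * k))) 1
    rw [norm_one] at h1
    have h2 : (1 - x) / x ^ k ≤ (x ^ k)⁻¹ - 1 := by
      rw [div_le_iff₀ hpos, sub_mul, inv_mul_cancel₀ hpos.ne']
      linarith
    linarith
  have hd0 : 0 < (1 - x) / x ^ k := div_pos (by linarith) hpos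
  refine ⟨fun h => ?_, ?_⟩
  · rw [h] at hd
    simp only [sub_self, norm_zero] at hd
    linarith
  · rw [sinhTerm, norm_div]
    calc _ ≤ ‖binCoeff ((‖s₀‖ + 1 : ℝ) : ℂ) k‖ / ((1 - x) / x ^ k) := by
          gcongr
          exact norm_binCoeff_le hs1 k
      _ = _ := by rw [div_div_eq_mul_div]

theorem meromorphic_sinhTerm (L : ℝ) (k : ℕ) (s : ℂ) : MeromorphicAt (sinhTerm L k) s := by
  refine MeromorphicAt.fun_div (AnalyticAt.meromorphicAt ?_) (AnalyticAt.meromorphicAt ?_)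
  · exact (differentiable_binCoeff k).analyticAt s
  · fun_prop

theorem differentiableAt_sinhTerm {L : ℝ} {k : ℕ} {s : ℂ}
    (h : Complex.exp (2 * L * (s + 2 * k)) ≠ 1) : DifferentiableAt ℂ (sinhTerm L k) s :=
  (differentiable_binCoeff k s).fun_div (by fun_prop) (sub_ne_zero.2 h)

theorem analyticAt_sinhTerm {L : ℝ} {k : ℕ} {s : ℂ}
    (h : Complex.exp (2 * L * (s + 2 * k)) ≠ 1) : AnalyticAt ℂ (sinhTerm L k) s :=
  ((differentiable_binCoeff k).analyticAt s).fun_div (by fun_prop) (sub_ne_zero.2 h)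

theorem exists_sinhZeta_eq {L : ℝ} (hL : 0 < L) (s₀ : ℂ) :
    ∃ N : ℕ, ∃ g : ℂ → ℂ, AnalyticAt ℂ g s₀ ∧
      (∀ k ≥ N, Complex.exp (2 * L * (s₀ + 2 * k)) ≠ 1) ∧
      ∀ᶠ s in 𝓝 s₀, sinhZeta L s = ∑ k ∈ Finset.range N, sinhTerm L k s + g s := by
  obtain ⟨N, u, hu, h⟩ := exists_tail_bound_sinhTerm hL s₀
  have hs₀ : s₀ ∈ Metric.ball s₀ 1 := Metric.mem_ball_self one_pos
  obtain ⟨g, hg, hg'⟩ := exists_analyticAt_tsum_eq (f := sinhTerm L) (Finset.range N)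
    Metric.isOpen_ball hs₀ hu
    (fun k hk s hs => (differentiableAt_sinhTerm
      (h k (by simpa using hk) s hs).1).differentiableWithinAt)
    (fun k hk s hs => (h k (by simpa using hk) s hs).2)
  refine ⟨N, g, hg, fun k hk => (h k hk s₀ hs₀).1, ?_⟩
  filter_upwards [Metric.isOpen_ball.mem_nhds hs₀] with s hs using (hg' s hs).2

theorem meromorphic_sinhZeta {L : ℝ} (hL : 0 < L) : Meromorphic (sinhZeta L) := by
  intro s₀
  obtain ⟨N, g, hg, -, h⟩ := exists_sinhZeta_eq hL s₀
  refine MeromorphicAt.congr (f := fun s => ∑ k ∈ Finset.range N, sinhTerm L k s + g s) ?_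
    ((EventuallyEq.symm h).filter_mono nhdsWithin_le_nhds)
  exact (MeromorphicAt.fun_sum fun k _ => meromorphic_sinhTerm L k s₀).fun_add hg.meromorphicAt

theorem analyticAt_sinhZeta {L : ℝ} (hL : 0 < L) {s₀ : ℂ}
    (hs₀ : ∀ k : ℕ, Complex.exp (2 * L * (s₀ + 2 * k)) ≠ 1) : AnalyticAt ℂ (sinhZeta L) s₀ := by
  obtain ⟨N, g, hg, -, h⟩ := exists_sinhZeta_eq hL s₀
  refine AnalyticAt.congr (f := fun s => ∑ k ∈ Finset.range N, sinhTerm L k s + g s) ?_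
    (EventuallyEq.symm h)
  exact (Finset.analyticAt_fun_sum _ fun k _ => analyticAt_sinhTerm (hs₀ k)).fun_add hg

theorem meromorphicOrderAt_sinhTerm {L : ℝ} (hL : 0 < L) (m : ℤ) (k : ℕ) :
    meromorphicOrderAt (sinhTerm L k) (Real.pi * Complex.I * m / L - 2 * k) = -1 := by
  set s₀ : ℂ := Real.pi * Complex.I * m / L - 2 * k
  have hL' : (L : ℂ) ≠ 0 := by exact_mod_cast hL.ne'
  have hre : s₀.re = -2 * k := by
    have : (Real.pi * Complex.I * m / L : ℂ) = ((Real.pi * m / L : ℝ) : ℂ) * Complex.I := by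
      push_cast; ring
    simp only [s₀]
    rw [this, Complex.sub_re, Complex.re_ofReal_mul]
    simp
  have h1 : Complex.exp (2 * L * (s₀ + 2 * k)) = 1 := (exp_eq_one_iff_eq_sub hL).2 ⟨m, rfl⟩
  -- The zeros of the numerator are `0, -1, …, -(k-1)`, whereas `Re s₀ = -2k`.
  have hb : binCoeff s₀ k ≠ 0 := by
    refine binCoeff_ne_zero fun j hj h => ?_
    have h2 := congrArg Complex.re h
    rw [Complex.add_re, hre, Complex.natCast_re, Complex.zero_re] at h2
    have : (j : ℝ) < k := by exact_mod_cast hj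
    linarith [Nat.cast_nonneg (α := ℝ) j]
  have hden : meromorphicOrderAt (fun s => Complex.exp (2 * L * (s + 2 * k)) - 1) s₀ = 1 := by
    have hd : HasDerivAt (fun s : ℂ => Complex.exp (2 * L * (s + 2 * k)) - 1)
        (Complex.exp (2 * L * (s₀ + 2 * k)) * (2 * L)) s₀ := by
      have := (((hasDerivAt_id s₀).add_const (2 * (k : ℂ))).const_mul (2 * (L : ℂ))).cexp.sub_const 1
      simpa using this
    have h2 := meromorphicOrderAt_comp_of_deriv_ne_zero (f := (id : ℂ → ℂ))
      (g := fun s => Complex.exp (2 * L * (s + 2 * k)) - 1) (x := s₀) (by fun_prop)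
      (by rw [hd.deriv, h1]; simpa using hL')
    simp only [h1, sub_self, Function.id_comp] at h2
    rw [h2, meromorphicOrderAt_id]
  have hnum := (differentiable_binCoeff k).analyticAt s₀
  have e : sinhTerm L k = (fun s => binCoeff s k) *
      (fun s => Complex.exp (2 * L * (s + 2 * k)) - 1)⁻¹ := by
    funext s
    simp [sinhTerm, div_eq_mul_inv]
  rw [e, meromorphicOrderAt_mul_of_ne_zero hnum hb, meromorphicOrderAt_inv, hden]

theorem meromorphicOrderAt_sinhZeta {L : ℝ} (hL : 0 < L) (m : ℤ) (k : ℕ) :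
    meromorphicOrderAt (sinhZeta L) (Real.pi * Complex.I * m / L - 2 * k) = -1 := by
  have hk := meromorphicOrderAt_sinhTerm hL m k
  have h1 : Complex.exp (2 * L * ((Real.pi * Complex.I * m / L - 2 * k) + 2 * k)) = 1 :=
    (exp_eq_one_iff_eq_sub hL).2 ⟨m, rfl⟩
  -- Changing `k` to `j` multiplies the exponential by the real number `e^{4L(j-k)} ≠ 1`.
  have hne : ∀ j ≠ k, Complex.exp (2 * L * ((Real.pi * Complex.I * m / L - 2 * k) + 2 * j)) ≠ 1 := by
    intro j hj h
    have e : (2 * L * ((Real.pi * Complex.I * m / L - 2 * k) + 2 * j) : ℂ) =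
        2 * L * ((Real.pi * Complex.I * m / L - 2 * k) + 2 * k) +
          ((4 * L * ((j : ℝ) - k) : ℝ) : ℂ) := by
      push_cast; ring
    rw [e, Complex.exp_add, h1, one_mul, ← Complex.ofReal_exp, Complex.ofReal_eq_one,
      Real.exp_eq_one_iff] at h
    have : (j : ℝ) - k = 0 := by
      rcases mul_eq_zero.1 h with h | h
      · linarith
      · exact h
    exact hj (by exact_mod_cast sub_eq_zero.1 this)
  set s₀ : ℂ := Real.pi * Complex.I * m / L - 2 * k
  obtain ⟨N, g, hg, hN, h⟩ := exists_sinhZeta_eq hL s₀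
  have hkN : k ∈ Finset.range N := by
    by_contra hkN
    exact hN k (by simpa using hkN) h1
  have hrest : AnalyticAt ℂ
      (fun s => ∑ j ∈ (Finset.range N).erase k, sinhTerm L j s + g s) s₀ :=
    (Finset.analyticAt_fun_sum _ fun j hj =>
      analyticAt_sinhTerm (hne j (Finset.ne_of_mem_erase hj))).fun_add hg
  have e : sinhZeta L =ᶠ[𝓝[≠] s₀] sinhTerm L k +
      fun s => ∑ j ∈ (Finset.range N).erase k, sinhTerm L j s + g s := by
    filter_upwards [h.filter_mono nhdsWithin_le_nhds] with s hs
    rw [hs, Pi.add_apply, ← add_assoc, Finset.add_sum_erase _ (fun j => sinhTerm L j s) hkN]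
  rw [meromorphicOrderAt_congr e, meromorphicOrderAt_add_eq_left_of_lt hrest.meromorphicAt, hk]
  rw [hk]
  exact lt_of_lt_of_le (by decide) hrest.meromorphicOrderAt_nonneg

/-! ### The region of absolute convergence -/

theorem hasSum_exp_neg {w : ℂ} (hw : 0 < w.re) :
    HasSum (fun n : ℕ => Complex.exp (-((n + 1) * w))) (Complex.exp w - 1)⁻¹ := by
  have h1 : ‖Complex.exp (-w)‖ < 1 := by
    rw [Complex.norm_exp, Real.exp_lt_one_iff]
    simpa using hw
  have h := (hasSum_geometric_of_norm_lt_one h1).mul_left (Complex.exp (-w))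
  have e : Complex.exp (-w) * (1 - Complex.exp (-w))⁻¹ = (Complex.exp w - 1)⁻¹ := by
    rw [Complex.exp_neg, ← inv_inv (Complex.exp w)⁻¹, ← mul_inv, inv_inv, mul_sub, mul_one,
      mul_inv_cancel₀ (Complex.exp_ne_zero w)]
  rw [e] at h
  refine h.congr_fun fun n => ?_
  rw [← Complex.exp_nat_mul, ← Complex.exp_add]
  congr 1
  ring

/-- Factor out `e^t`; both factors are non-negative reals, so the complex power is multiplicative.
-/
theorem hasSum_binCoeff_mul_exp (s : ℂ) {t : ℝ} (ht : 0 < t) :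
    HasSum (fun k : ℕ => binCoeff s k * Complex.exp (-(t * (s + 2 * k))))
      (((Real.exp t - (Real.exp t)⁻¹ : ℝ) : ℂ) ^ (-s)) := by
  have hx : ‖Complex.exp (-(2 * t))‖ < 1 := by
    rw [Complex.norm_exp, Real.exp_lt_one_iff]
    simpa using ht
  have h := (hasSum_binCoeff_mul_pow s hx).mul_left (Complex.exp (-(t * s)))
  have e : ((Real.exp t - (Real.exp t)⁻¹ : ℝ) : ℂ) ^ (-s) =
      Complex.exp (-(t * s)) * (1 - Complex.exp (-(2 * t))) ^ (-s) := by
    have h1 : (1 - Complex.exp (-(2 * t)) : ℂ) = ((1 - Real.exp (-(2 * t)) : ℝ) : ℂ) := by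
      push_cast; rfl
    have h2 : Real.exp t - (Real.exp t)⁻¹ = Real.exp t * (1 - Real.exp (-(2 * t))) := by
      rw [mul_sub, ← Real.exp_add, ← Real.exp_neg]
      ring_nf
    have h3 : 0 ≤ 1 - Real.exp (-(2 * t)) := by
      rw [sub_nonneg, Real.exp_le_one_iff]
      linarith
    have h4 : Complex.exp (-(t * s)) = ((Real.exp t : ℝ) : ℂ) ^ (-s) := by
      rw [Complex.cpow_def_of_ne_zero (by exact_mod_cast (Real.exp_pos t).ne'),
        ← Complex.ofReal_log (Real.exp_pos t).le, Real.log_exp, mul_neg]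
    rw [h1, h2, Complex.ofReal_mul, Complex.mul_cpow_ofReal_nonneg (Real.exp_pos t).le h3, h4]
  rw [e]
  refine h.congr_fun fun k => ?_
  rw [← Complex.exp_nat_mul, mul_left_comm, ← Complex.exp_add]
  ring_nf

/-- Fubini for a double series dominated by `e^{-2Ln Re s} ‖b_k‖ e^{-4Lk}`. -/
theorem hasSum_sinhZeta {L : ℝ} (hL : 0 < L) {s : ℂ} (hs : 0 < s.re) :
    HasSum (fun n : ℕ => ((Real.exp (2 * (n + 1) * L) - (Real.exp (2 * (n + 1) * L))⁻¹ : ℝ) : ℂ) ^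
      (-s)) (sinhZeta L s) := by
  set F : ℕ × ℕ → ℂ := fun p =>
    binCoeff s p.2 * Complex.exp (-((2 * (p.1 + 1) * L : ℝ) * (s + 2 * p.2)))
  have hF : Summable F := by
    have hx : Real.exp (-(4 * L)) < 1 := by rw [Real.exp_lt_one_iff]; linarith
    have hy : Real.exp (-(2 * L * s.re)) < 1 := by
      rw [Real.exp_lt_one_iff]
      have := mul_pos hL hs
      linarith
    have h := (summable_geometric_of_lt_one (Real.exp_pos _).le hy).mul_of_nonneg
      (summable_norm_binCoeff_mul_pow s (Real.exp_pos _).le hx) (fun _ => by positivity)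
      (fun _ => by positivity)
    refine Summable.of_norm_bounded h fun p => ?_
    simp only [F]
    rw [norm_mul, mul_left_comm, Complex.norm_exp, ← Real.exp_nat_mul, ← Real.exp_nat_mul,
      ← Real.exp_add, Complex.neg_re, Complex.re_ofReal_mul]
    gcongr
    have h1 : (s + 2 * p.2).re = s.re + 2 * p.2 := by simp
    rw [h1]
    have : 0 ≤ L * s.re + 4 * (p.1 * (p.2 * L)) := by positivity
    nlinarith [mul_pos hL hs]
  have h1 := hF.hasSum.prod_fiberwise fun n =>
    hasSum_binCoeff_mul_exp s (t := 2 * ((n : ℝ) + 1) * L) (by positivity)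
  have h2 := ((Equiv.prodComm ℕ ℕ).hasSum_iff.2 hF.hasSum).prod_fiberwise (g := fun k =>
    sinhTerm L k s) fun k => by
      have hw : 0 < (2 * L * (s + 2 * k) : ℂ).re := by
        rw [show (2 * L * (s + 2 * k) : ℂ) = ((2 * L : ℝ) : ℂ) * (s + 2 * k) by push_cast; rfl,
          Complex.re_ofReal_mul]
        simp only [Complex.add_re, Complex.mul_re, Complex.re_ofNat, Complex.natCast_re,
          Complex.im_ofNat, Complex.natCast_im, mul_zero, sub_zero]
        positivity
      refine ((hasSum_exp_neg hw).mul_left (binCoeff s k)).congr_fun fun n => ?_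
      simp only [F, Function.comp, Equiv.prodComm_apply, Prod.swap]
      push_cast
      ring_nf
  rw [sinhZeta, h2.tsum_eq]
  exact h1

/-! ### The Fibonacci sequence of a real quadratic field -/

theorem irrational_sqrt_of_squarefree {D : ℕ} (hD : Squarefree D) (hD1 : 1 < D) :
    Irrational √(D : ℝ) := by
  rw [irrational_sqrt_natCast_iff]
  rintro ⟨r, hr⟩
  have h := hD r ⟨1, by rw [hr, mul_one]⟩
  rw [Nat.isUnit_iff] at h
  subst h
  omega

theorem irrational_sqrt_q {D : ℕ} (hD : Squarefree D) (hD1 : 1 < D) : Irrational √(q D : ℝ) := by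
  have h := irrational_sqrt_of_squarefree hD hD1
  unfold q
  split_ifs
  · exact h
  · push_cast
    rw [Real.sqrt_mul (by norm_num), show (4 : ℝ) = 2 ^ 2 by norm_num, Real.sqrt_sq (by norm_num)]
    exact_mod_cast h.natCast_mul two_ne_zero

theorem isIntegral_sqrt (D : ℕ) : IsIntegral ℚ √(D : ℝ) := by
  refine IsIntegral.of_pow (n := 2) two_pos ?_
  rw [Real.sq_sqrt (Nat.cast_nonneg D)]
  exact isIntegral_algebraMap (x := (D : ℚ))

theorem finrank_quadField {D : ℕ} (hD : Squarefree D) (hD1 : 1 < D) :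
    Module.finrank ℚ (QuadField D) = 2 := by
  have hi := isIntegral_sqrt D
  rw [IntermediateField.adjoin.finrank hi]
  apply le_antisymm
  · have hm : (Polynomial.X ^ 2 - Polynomial.C (D : ℚ)).Monic :=
      Polynomial.monic_X_pow_sub_C _ two_ne_zero
    have h := minpoly.min ℚ √(D : ℝ) hm (by simp)
    have h2 := Polynomial.natDegree_le_natDegree h
    rwa [Polynomial.natDegree_X_pow_sub_C] at h2
  · rw [minpoly.two_le_natDegree_iff hi]
    rintro ⟨r, hr⟩
    exact irrational_sqrt_of_squarefree hD hD1 ⟨r, by simpa using hr⟩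

/-- The Galois group has order two. If `σ` fixed `√q`, the trace of `√q` would be `2√q`, making `√q`
rational. -/
theorem exists_conj_quadField {D : ℕ} (hD : Squarefree D) (hD1 : 1 < D) :
    ∃ σ : QuadField D →+* QuadField D, σ (sqrtQ D) = -sqrtQ D ∧
      (∀ x, algebraMap ℚ (QuadField D) (Algebra.trace ℚ (QuadField D) x) = x + σ x) ∧
      ∀ x, algebraMap ℚ (QuadField D) (Algebra.norm ℚ x) = x * σ x := by
  have : FiniteDimensional ℚ (QuadField D) :=
    IntermediateField.adjoin.finiteDimensional (isIntegral_sqrt D)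
  classical
  have : Algebra.IsQuadraticExtension ℚ (QuadField D) := ⟨finrank_quadField hD hD1⟩
  have hcard : (Finset.univ : Finset (Gal(QuadField D/ℚ))).card = 2 := by
    rw [Finset.card_univ, ← Nat.card_eq_fintype_card, IsGalois.card_aut_eq_finrank,
      finrank_quadField hD hD1]
  obtain ⟨σ, hσ, huniv⟩ : ∃ σ : Gal(QuadField D/ℚ), 1 ≠ σ ∧ Finset.univ = {1, σ} := by
    obtain ⟨a, b, hab, h⟩ := Finset.card_eq_two.1 hcard
    have h1 : (1 : Gal(QuadField D/ℚ)) ∈ ({a, b} : Finset _) := h ▸ Finset.mem_univ _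
    rw [Finset.mem_insert, Finset.mem_singleton] at h1
    rcases h1 with rfl | rfl
    · exact ⟨b, hab, h⟩
    · exact ⟨a, hab.symm, by rw [h, Finset.pair_comm]⟩
  have htr : ∀ x, algebraMap ℚ (QuadField D) (Algebra.trace ℚ (QuadField D) x) = x + σ x := by
    intro x
    rw [trace_eq_sum_automorphisms, huniv, Finset.sum_pair hσ]
    rfl
  refine ⟨σ, ?_, htr, fun x => ?_⟩
  · have hsq : sqrtQ D ^ 2 = (q D : QuadField D) := by
      apply Subtype.ext
      simp [sqrtQ, Real.sq_sqrt]
    have h1 : σ (sqrtQ D) ^ 2 = sqrtQ D ^ 2 := by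
      rw [← map_pow, hsq, map_natCast]
    rcases sq_eq_sq_iff_eq_or_eq_neg.1 h1 with h | h
    · exfalso
      have h2 := htr (sqrtQ D)
      rw [h] at h2
      have h3 := congrArg (fun x : QuadField D => (x : ℝ)) h2
      refine irrational_sqrt_q hD hD1 ⟨Algebra.trace ℚ (QuadField D) (sqrtQ D) / 2, ?_⟩
      simp [sqrtQ] at h3
      push_cast
      simp [sqrtQ]
      linarith
    · exact h
  · rw [Algebra.norm_eq_prod_automorphisms, huniv, Finset.prod_pair hσ]
    rfl

/-- The even exponent removes the sign of the norm of `ε`: `σ(ε)^{2n}` is `ε^{-2n}` whether that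
norm is `1` or `-1`. -/
theorem fib_two_mul {D : ℕ} (hD : Squarefree D) (hD1 : 1 < D) (ε : (𝓞 (QuadField D))ˣ) (n : ℕ) :
    (fib ε (2 * n) : ℝ) = (unitToReal ε ^ (2 * n) - (unitToReal ε ^ (2 * n))⁻¹) / √(q D : ℝ) := by
  obtain ⟨σ, hσ, htr, hnorm⟩ := exists_conj_quadField hD hD1
  have : FiniteDimensional ℚ (QuadField D) :=
    IntermediateField.adjoin.finiteDimensional (isIntegral_sqrt D)
  have : NumberField (QuadField D) := ⟨⟩
  set x : QuadField D := ((ε : 𝓞 (QuadField D)) : QuadField D) with hx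
  have hN : (Algebra.norm ℚ x) ^ 2 = 1 := by
    rw [← sq_abs, NumberField.Units.norm, one_pow]
  have h1 : x ^ (2 * n) * σ x ^ (2 * n) = 1 := by
    rw [← mul_pow, ← hnorm, pow_mul, ← map_pow, hN, map_one, one_pow]
  have h2 := htr (x ^ (2 * n) / sqrtQ D)
  rw [map_div₀ σ, map_pow σ, hσ, eq_inv_of_mul_eq_one_right h1] at h2
  have e : (fib ε (2 * n) : ℝ) =
      ((algebraMap ℚ (QuadField D) (fib ε (2 * n)) : QuadField D) : ℝ) := by simp
  rw [e, show algebraMap ℚ (QuadField D) (fib ε (2 * n)) = _ from h2,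
    show unitToReal ε = (x : ℝ) from rfl, show √(q D : ℝ) = (sqrtQ D : ℝ) from rfl]
  push_cast
  ring

theorem one_div_fib_cpow {D : ℕ} (hD : Squarefree D) (hD1 : 1 < D) (ε : (𝓞 (QuadField D))ˣ)
    (hε : 1 < unitToReal ε) (n : ℕ) (s : ℂ) :
    1 / (fib ε (2 * (n + 1)) : ℂ) ^ s = (q D : ℂ) ^ (s / 2) *
      ((unitToReal ε ^ (2 * (n + 1)) - (unitToReal ε ^ (2 * (n + 1)))⁻¹ : ℝ) : ℂ) ^ (-s) := by
  have hX : 1 < unitToReal ε ^ (2 * (n + 1)) := one_lt_pow₀ hε (by omega)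
  set X := unitToReal ε ^ (2 * (n + 1))
  have hq : 0 < (q D : ℝ) := by
    have : 0 < q D := by unfold q; split_ifs <;> omega
    exact_mod_cast this
  have hX1 : 0 ≤ X - X⁻¹ := by
    have := inv_lt_one_of_one_lt₀ hX
    linarith
  have e : (fib ε (2 * (n + 1)) : ℂ) = ((X - X⁻¹ : ℝ) : ℂ) * (((√(q D : ℝ))⁻¹ : ℝ) : ℂ) := by
    rw [← Complex.ofReal_mul, ← div_eq_mul_inv, ← fib_two_mul hD hD1]
    push_cast
    rfl
  rw [e, Complex.mul_cpow_ofReal_nonneg hX1 (by positivity), one_div, mul_inv, Complex.cpow_neg,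
    mul_comm]
  congr 1
  have harg : ((√(q D : ℝ) : ℝ) : ℂ).arg ≠ Real.pi := by
    rw [Complex.arg_ofReal_of_nonneg (Real.sqrt_nonneg _)]
    exact Real.pi_ne_zero.symm
  rw [Complex.ofReal_inv, Complex.inv_cpow _ _ harg, inv_inv,
    Complex.cpow_def_of_ne_zero (by exact_mod_cast (Real.sqrt_pos.2 hq).ne'),
    Complex.cpow_def_of_ne_zero (by exact_mod_cast hq.ne'), ← Complex.ofReal_log (Real.sqrt_nonneg _),
    Real.log_sqrt hq.le, ← Complex.natCast_log]
  push_cast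
  ring_nf

/-! ### The expansion in the left half-plane -/

theorem hasSum_telescope {r : ℝ} (hr : 0 < r) :
    HasSum (fun n : ℕ => 8 * r * (1 / (n + r) - 1 / ((n + 1 : ℕ) + r))) 8 := by
  have h : Tendsto (fun n : ℕ => 1 / ((n : ℝ) + r)) atTop (𝓝 0) :=
    tendsto_const_nhds.div_atTop (tendsto_atTop_add_const_right _ _ tendsto_natCast_atTop_atTop)
  rw [hasSum_iff_tendsto_nat_of_nonneg]
  · simp_rw [← Finset.mul_sum, Finset.sum_range_sub' (fun n : ℕ => 1 / ((n : ℝ) + r))]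
    convert (h.const_sub (1 / (((0 : ℕ) : ℝ) + r))).const_mul (8 * r) using 2
    rw [Nat.cast_zero, zero_add, sub_zero]
    field_simp
  · intro n
    have : 1 / (((n + 1 : ℕ) : ℝ) + r) ≤ 1 / ((n : ℝ) + r) := by
      gcongr
      omega
    have := sub_nonneg.2 this
    positivity

/-- The term is `2x / (x² - m²)`. Since `Im x` dominates `Re x`, there is no cancellation in the
denominator. The sum of the majorant is `8` whatever `r` is, which gives uniformity in `k` later. -/
theorem norm_cotTerm_le {x : ℂ} (hx : x ∈ Complex.integerComplement) {r : ℝ} (hr : 0 < r)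
    (him : |x.im| = r) (hre : 2 * |x.re| ≤ r) (n : ℕ) :
    ‖cotTerm x n‖ ≤ 8 * r * (1 / (n + r) - 1 / ((n + 1 : ℕ) + r)) := by
  set m : ℝ := n + 1 with hm
  have hm0 : 0 < m := by positivity
  have e1 : cotTerm x n = 2 * x / (x ^ 2 - m ^ 2) := by
    rw [cotTerm_identity hx, hm]
    push_cast
    rw [mul_one_div]
    ring_nf
  have hsq : x.im ^ 2 = r ^ 2 := by rw [← him, sq_abs]
  have hsq2 : x.re ^ 2 ≤ r ^ 2 / 4 := by
    rw [← sq_abs]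
    nlinarith [abs_nonneg x.re]
  have h1 : m ^ 2 + 3 / 4 * r ^ 2 ≤ ‖x ^ 2 - (m : ℂ) ^ 2‖ := by
    have h := (neg_le_abs _).trans (Complex.abs_re_le_norm (x ^ 2 - (m : ℂ) ^ 2))
    have e : (x ^ 2 - (m : ℂ) ^ 2).re = x.re ^ 2 - x.im ^ 2 - m ^ 2 := by
      rw [← Complex.ofReal_pow, Complex.sub_re, Complex.ofReal_re, sq, Complex.mul_re]
      ring
    rw [e] at h
    linarith
  have h2 : ‖x‖ ≤ 3 / 2 * r := by
    refine (Complex.norm_le_abs_re_add_abs_im x).trans ?_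
    linarith
  have e3 : ((n + 1 : ℕ) : ℝ) + r = m + r := by rw [hm]; push_cast; rfl
  have e4 : (n : ℝ) + r = m + r - 1 := by rw [hm]; ring
  have h5 : 0 < m + r - 1 := by rw [← e4]; positivity
  rw [e1, e3, e4, norm_div, norm_mul, Complex.norm_two]
  calc 2 * ‖x‖ / ‖x ^ 2 - (m : ℂ) ^ 2‖ ≤ 2 * (3 / 2 * r) / (m ^ 2 + 3 / 4 * r ^ 2) := by gcongr
    _ ≤ 8 * r * (1 / ((m + r - 1) * (m + r))) := by
      rw [← mul_div_assoc, div_le_div_iff₀ (by positivity) (by positivity)]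
      have : (m + r - 1) * (m + r) ≤ (m + r) * (m + r) := by nlinarith
      have : 3 * ((m + r) * (m + r)) ≤ 8 * (m ^ 2 + 3 / 4 * r ^ 2) := by
        nlinarith [sq_nonneg (m - r)]
      nlinarith
    _ = _ := by
      rw [div_sub_div _ _ h5.ne' (by positivity)]
      congr 2
      ring

/-- The Mittag-Leffler expansion of the cotangent, rewritten. -/
theorem inv_exp_sub_one_eq {x : ℂ} (hx : x ∈ Complex.integerComplement) :
    (Complex.exp (2 * Real.pi * Complex.I * x) - 1)⁻¹ =
      -1 / 2 + 1 / (2 * Real.pi * Complex.I) * (1 / x + ∑' n, cotTerm x n) := by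
  have h := cot_series_rep' hx
  have hpi : (Real.pi : ℂ) ≠ 0 := by exact_mod_cast Real.pi_ne_zero
  have hE : Complex.exp (2 * Real.pi * Complex.I * x) ≠ 1 := by
    intro h0
    obtain ⟨n, hn⟩ := Complex.exp_eq_one_iff.1 h0
    refine hx ⟨n, ?_⟩
    have hI := Complex.I_ne_zero
    have : 2 * Real.pi * Complex.I ≠ 0 := by simp [hpi]
    apply mul_left_cancel₀ this
    rw [hn]
    ring
  have e : (1 / x + ∑' n, cotTerm x n) = Real.pi * Complex.cot (Real.pi * x) := by
    rw [show (∑' n, cotTerm x n) = _ from h.symm]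
    ring
  rw [e, Complex.cot_pi_eq_exp_ratio]
  have h1 := sub_ne_zero.2 hE
  have h2 := sub_ne_zero.2 hE.symm
  have hI := Complex.I_ne_zero
  field_simp
  rw [Complex.I_sq]
  ring

/-- For large `k` the row of cotangent terms has absolute sum at most `8`, so `∑ ‖b_k‖` dominates.
-/
theorem summable_binCoeff_mul_cotTerm {s : ℂ} (hs : s.re < 0) {x : ℕ → ℂ}
    (hx : ∀ k, x k ∈ Complex.integerComplement)
    (hre : ∀ᶠ k in atTop, 2 * |(x k).re| ≤ |(x k).im|) (him : ∀ᶠ k in atTop, 0 < |(x k).im|) :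
    Summable fun p : ℕ × ℕ => binCoeff s p.1 * cotTerm (x p.1) p.2 := by
  apply Summable.of_norm
  rw [summable_prod_of_nonneg fun p => norm_nonneg _]
  refine ⟨fun k => (summable_cotTerm (hx k)).norm.mul_left ‖binCoeff s k‖ |>.congr
    fun n => (norm_mul _ _).symm, ?_⟩
  refine Summable.of_norm_bounded_eventually_nat ((summable_norm_binCoeff hs).mul_right 8) ?_
  filter_upwards [hre, him] with k h1 h2
  simp_rw [norm_mul]
  rw [tsum_mul_left, norm_mul, norm_norm]
  gcongr
  rw [Real.norm_of_nonneg (tsum_nonneg fun _ => norm_nonneg _)]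
  exact hasSum_le (norm_cotTerm_le (hx k) h2 rfl h1) (summable_cotTerm (hx k)).norm.hasSum
    (hasSum_telescope h2)

theorem exp_ne_one_of_notMem_poleSet {e : ℝ} (he : 1 < e) {s : ℂ} (hs : s ∉ poleSet e) (k : ℕ) :
    Complex.exp (2 * Real.log e * (s + 2 * k)) ≠ 1 := fun h =>
  let ⟨m, hm⟩ := (exp_eq_one_iff_eq_sub (Real.log_pos he)).1 h
  hs ⟨m, k, hm⟩

theorem re_half_sub_log (e : ℝ) (s : ℂ) (m : ℤ) :
    (s / 2 - Real.pi * Complex.I * m / (2 * Real.log e)).re = s.re / 2 := by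
  have : (Real.pi * Complex.I * m / (2 * Real.log e) : ℂ) =
      ((Real.pi * m / (2 * Real.log e) : ℝ) : ℂ) * Complex.I := by
    push_cast; ring
  rw [this, Complex.sub_re, Complex.re_ofReal_mul]
  simp

theorem tsum_binCoeff_div_eq_gammaRatio {e : ℝ} (he : 1 < e) {s : ℂ} (hs : s.re < 0)
    (hP : s ∉ poleSet e) (m : ℤ) :
    ∑' k : ℕ, binCoeff s k / (k + (s / 2 - Real.pi * Complex.I * m / (2 * Real.log e))) =
      Complex.Gamma (1 - s) * gammaRatio e s m := by
  have hL : (Real.log e : ℂ) ≠ 0 := by exact_mod_cast (Real.log_pos he).ne'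
  rw [tsum_binCoeff_div hs, gammaRatio, mul_div_assoc]
  · congr 3
    ring
  · intro k h
    refine hP ⟨m, k, ?_⟩
    have h2 : (2 * Real.log e : ℂ) ≠ 0 := by simpa using hL
    field_simp at h ⊢
    linear_combination h
  · intro k h
    have h1 := congrArg Complex.re h
    rw [Complex.add_re, Complex.sub_re, Complex.add_re, re_half_sub_log, Complex.natCast_re,
      Complex.one_re, Complex.zero_re] at h1
    linarith [Nat.cast_nonneg (α := ℝ) k]

/-- Interchange of summation: rows give partial fractions of `1 / (e^w - 1)`, columns give Beta
values. The indices `±(n+1)` stay paired because the partial fractions converge absolutely only in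
pairs. -/
theorem hasSum_gammaRatio_pair {e : ℝ} (he : 1 < e) {s : ℂ} (hs : s.re < 0) (hP : s ∉ poleSet e) :
    HasSum (fun n : ℕ => Complex.Gamma (1 - s) / (4 * Real.log e) *
        (gammaRatio e s (n + 1) + gammaRatio e s (-(n + 1))))
      (sinhZeta (Real.log e) s - Complex.Gamma (1 - s) / (4 * Real.log e) * gammaRatio e s 0) := by
  have hL := Real.log_pos he
  have hE := exp_ne_one_of_notMem_poleSet he hP
  have hT := tsum_binCoeff_div_eq_gammaRatio he hs hP
  set L := Real.log e
  have hL' : (L : ℂ) ≠ 0 := by exact_mod_cast hL.ne'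
  have hpi : (Real.pi : ℂ) ≠ 0 := by exact_mod_cast Real.pi_ne_zero
  have hI := Complex.I_ne_zero
  set a : ℤ → ℂ := fun m => s / 2 - Real.pi * Complex.I * m / (2 * L)
  -- Chosen so that `2πi x_k = 2L(s + 2k)`. As `k` grows `|Re x_k|` is constant and `|Im x_k|` tends
  -- to infinity, as the cotangent bound requires.
  set x : ℕ → ℂ := fun k => L * (s + 2 * k) / (Real.pi * Complex.I)
  have hwx : ∀ k : ℕ, 2 * Real.pi * Complex.I * x k = 2 * L * (s + 2 * k) := by
    intro k
    simp only [x]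
    field_simp
  have hx : ∀ k, x k ∈ Complex.integerComplement := by
    rintro k ⟨n, hn⟩
    refine hE k (Complex.exp_eq_one_iff.2 ⟨n, ?_⟩)
    rw [← hwx, ← hn]
    ring
  have hxr : ∀ k : ℕ, x k = ((L / Real.pi : ℝ) : ℂ) * (-(Complex.I * (s + 2 * k))) := by
    intro k
    simp only [x]
    push_cast
    field_simp
    rw [Complex.I_sq]
    ring
  have hc : 0 < L / Real.pi := div_pos hL Real.pi_pos
  have hxre : ∀ k : ℕ, |(x k).re| = L / Real.pi * |s.im| := by
    intro k
    rw [hxr, Complex.re_ofReal_mul, abs_mul, abs_of_pos hc]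
    simp
  have hxim : ∀ k : ℕ, |(x k).im| = L / Real.pi * |s.re + 2 * k| := by
    intro k
    rw [hxr, Complex.im_ofReal_mul, abs_mul, abs_of_pos hc]
    congr 1
    rw [← abs_neg]
    simp
  have hre : ∀ᶠ k in atTop, 2 * |(x k).re| ≤ |(x k).im| := by
    obtain ⟨N, hN⟩ := exists_nat_ge (2 * |s.im| - s.re)
    filter_upwards [eventually_ge_atTop N] with k hk
    have hk' : (N : ℝ) ≤ k := by exact_mod_cast hk
    rw [hxre, hxim, mul_left_comm]
    gcongr
    refine le_trans ?_ (le_abs_self _)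
    linarith [Nat.cast_nonneg (α := ℝ) k]
  have him : ∀ᶠ k in atTop, 0 < |(x k).im| := by
    obtain ⟨N, hN⟩ := exists_nat_gt (-s.re)
    filter_upwards [eventually_ge_atTop N] with k hk
    have hk' : (N : ℝ) ≤ k := by exact_mod_cast hk
    rw [hxim]
    have : 0 < s.re + 2 * k := by linarith [Nat.cast_nonneg (α := ℝ) k]
    positivity
  have hF := (summable_binCoeff_mul_cotTerm hs hx hre him).mul_left
    (1 / (2 * Real.pi * Complex.I))
  have frac : ∀ (k : ℕ) (m : ℤ), 1 / (2 * Real.pi * Complex.I) * (1 / (x k - m)) =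
      1 / (4 * L) * (1 / (k + a m)) := by
    intro k m
    rw [div_mul_div_comm, div_mul_div_comm, mul_sub, hwx]
    congr 1
    simp only [a]
    field_simp
    ring
  have S0 := (summable_norm_binCoeff hs).of_norm
  have Sa := fun m => (summable_norm_binCoeff_div hs (a m)).of_norm
  have hcol : ∀ n : ℕ, HasSum (fun k : ℕ => 1 / (2 * Real.pi * Complex.I) *
      (binCoeff s k * cotTerm (x k) n)) (Complex.Gamma (1 - s) / (4 * L) *
        (gammaRatio e s (n + 1) + gammaRatio e s (-(n + 1)))) := by
    intro n
    have h := (((Sa (n + 1)).hasSum).add ((Sa (-(n + 1))).hasSum)).mul_left (1 / (4 * L : ℂ))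
    rw [hT, hT, ← mul_add, ← mul_assoc, one_div_mul_eq_div] at h
    refine h.congr_fun fun k => ?_
    have f1 := frac k (n + 1)
    have f2 := frac k (-(n + 1))
    push_cast at f1 f2
    rw [sub_neg_eq_add] at f2
    rw [cotTerm]
    simp only [div_eq_mul_one_div (binCoeff s k)]
    linear_combination binCoeff s k * f1 + binCoeff s k * f2
  have hrow : ∀ k : ℕ, HasSum (fun n : ℕ => 1 / (2 * Real.pi * Complex.I) *
      (binCoeff s k * cotTerm (x k) n))
      (sinhTerm L k s - (-1 / 2 * binCoeff s k + 1 / (4 * L) * (binCoeff s k / (k + a 0)))) := by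
    intro k
    refine (congrArg (HasSum _ · _) ?_).mpr (((summable_cotTerm (hx k)).hasSum.mul_left
      (binCoeff s k)).mul_left (1 / (2 * Real.pi * Complex.I)))
    have f0 := frac k 0
    rw [Int.cast_zero, sub_zero] at f0
    rw [sinhTerm, ← hwx, div_eq_mul_inv, inv_exp_sub_one_eq (hx k),
      div_eq_mul_one_div (binCoeff s k)]
    linear_combination binCoeff s k * f0
  have h1 := hF.hasSum.prod_fiberwise hrow
  have h2 := ((Equiv.prodComm ℕ ℕ).hasSum_iff.2 hF.hasSum).prod_fiberwise hcol
  -- Restores the `m = 0` fraction and the constant `-1/2`, whose total is `-1/2 ∑ b_k = 0`.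
  have h3 := h1.add ((S0.hasSum.mul_left (-1 / 2)).add ((Sa 0).hasSum.mul_left (1 / (4 * L : ℂ))))
  rw [tsum_binCoeff hs, hT 0] at h3
  have h4 := h3.congr_fun (g := fun k => sinhTerm L k s) fun k => by ring
  refine (congrArg (HasSum _ · _) ?_).mpr h2
  rw [sinhZeta, h4.tsum_eq]
  ring

/-! ### The difference between the Gamma quotients and their leading asymptotics -/

/-- The Gamma quotient minus its leading asymptotic term as `|m| → ∞`. -/
noncomputable def gammaDefect (e : ℝ) (m : ℤ) (s : ℂ) : ℂ :=
  gammaRatio e s m -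
    (-Complex.I * (Real.pi * m / (2 * Real.log e) : ℝ)) ^ (s - 1)

theorem gammaRatio_eq (e : ℝ) (s : ℂ) (m : ℤ) :
    gammaRatio e s m =
      Complex.Gamma (s / 2 - Complex.I * (Real.pi * m / (2 * Real.log e) : ℝ)) *
        (Complex.Gamma (1 - s / 2 - Complex.I * (Real.pi * m / (2 * Real.log e) : ℝ)))⁻¹ := by
  rw [gammaRatio, div_eq_mul_inv]
  push_cast
  ring_nf

theorem analyticAt_Gamma {s : ℂ} (hs : ∀ k : ℕ, s ≠ -k) : AnalyticAt ℂ Complex.Gamma s := by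
  have h := (Complex.differentiable_one_div_Gamma.analyticAt s).fun_inv
    (inv_ne_zero (Complex.Gamma_ne_zero hs))
  simpa using h

theorem analyticAt_gammaRatio {e : ℝ} {m : ℤ} {s : ℂ}
    (hs : ∀ k : ℕ, s / 2 - Complex.I * (Real.pi * m / (2 * Real.log e) : ℝ) ≠ -k) :
    AnalyticAt ℂ (fun s => gammaRatio e s m) s := by
  simp_rw [gammaRatio_eq]
  refine AnalyticAt.fun_mul ?_ ?_
  · exact (analyticAt_Gamma hs).fun_comp
      (f := fun s : ℂ => s / 2 - Complex.I * (Real.pi * m / (2 * Real.log e) : ℝ)) (by fun_prop)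
  · exact (Complex.differentiable_one_div_Gamma.analyticAt _).fun_comp
      (f := fun s : ℂ => 1 - s / 2 - Complex.I * (Real.pi * m / (2 * Real.log e) : ℝ)) (by fun_prop)

theorem meromorphicAt_gammaRatio (e : ℝ) (m : ℤ) (s : ℂ) :
    MeromorphicAt (fun s => gammaRatio e s m) s := by
  simp_rw [gammaRatio_eq]
  refine MeromorphicAt.fun_mul ?_ (AnalyticAt.meromorphicAt ?_)
  · exact (Meromorphic.Gamma _).comp_analyticAt
      (g := fun s : ℂ => s / 2 - Complex.I * (Real.pi * m / (2 * Real.log e) : ℝ)) (by fun_prop)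
  · exact (Complex.differentiable_one_div_Gamma.analyticAt _).fun_comp
      (f := fun s : ℂ => 1 - s / 2 - Complex.I * (Real.pi * m / (2 * Real.log e) : ℝ)) (by fun_prop)

theorem half_sub_ne_of_notMem_poleSet {e : ℝ} (he : 1 < e) {s : ℂ} (hs : s ∉ poleSet e) (m : ℤ)
    (k : ℕ) : s / 2 - Complex.I * (Real.pi * m / (2 * Real.log e) : ℝ) ≠ -k := by
  intro h
  have hL : (Real.log e : ℂ) ≠ 0 := by exact_mod_cast (Real.log_pos he).ne'
  refine hs ⟨m, k, ?_⟩
  push_cast at h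
  linear_combination 2 * h

theorem neg_I_mul_ne_zero {e : ℝ} (he : 1 < e) {m : ℤ} (hm : m ≠ 0) :
    -Complex.I * (Real.pi * m / (2 * Real.log e) : ℝ) ≠ 0 := by
  have h : Real.pi * m / (2 * Real.log e) ≠ 0 := by
    have := Real.log_pos he
    have h1 : (m : ℝ) ≠ 0 := by exact_mod_cast hm
    positivity
  exact mul_ne_zero (neg_ne_zero.2 Complex.I_ne_zero) (by exact_mod_cast h)

theorem analyticAt_const_cpow {c : ℂ} (hc : c ≠ 0) {g : ℂ → ℂ} {s : ℂ} (hg : AnalyticAt ℂ g s) :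
    AnalyticAt ℂ (fun s => c ^ g s) s := by
  simp_rw [Complex.cpow_def_of_ne_zero hc]
  fun_prop

theorem analyticAt_gammaDefect {e : ℝ} (he : 1 < e) {m : ℤ} (hm : m ≠ 0) {s : ℂ}
    (hs : ∀ k : ℕ, s / 2 - Complex.I * (Real.pi * m / (2 * Real.log e) : ℝ) ≠ -k) :
    AnalyticAt ℂ (gammaDefect e m) s :=
  (analyticAt_gammaRatio hs).fun_sub (analyticAt_const_cpow (neg_I_mul_ne_zero he hm) (by fun_prop))

theorem meromorphicAt_gammaDefect {e : ℝ} (he : 1 < e) {m : ℤ} (hm : m ≠ 0) (s : ℂ) :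
    MeromorphicAt (gammaDefect e m) s :=
  (meromorphicAt_gammaRatio e m s).fun_sub
    (analyticAt_const_cpow (neg_I_mul_ne_zero he hm) (by fun_prop)).meromorphicAt

/-- The defect is `O(|m|^{Re s - 3})`, which is summable exactly when `Re s < 2`. -/
theorem exists_tail_bound_gammaDefect {e : ℝ} (he : 1 < e) {s₀ : ℂ} (hs₀ : s₀.re < 2) :
    ∃ (T : Finset {m : ℤ // m ≠ 0}) (U : Set ℂ) (u : {m : ℤ // m ≠ 0} → ℝ), IsOpen U ∧ s₀ ∈ U ∧
      Summable u ∧ (∀ m ∉ T, DifferentiableOn ℂ (gammaDefect e m) U) ∧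
      ∀ m ∉ T, ∀ s ∈ U, ‖gammaDefect e m s‖ ≤ u m := by
  have hL := Real.log_pos he
  set L := Real.log e with hLe
  obtain ⟨C, Y, hCY⟩ := norm_Gamma_div_Gamma_sub_le (‖s₀‖ + 1)
  -- Half the distance to the line `Re s = 2`: on the ball the exponent stays at most `-(1 + δ)`.
  set δ : ℝ := (2 - s₀.re) / 2 with hδ
  have hδ0 : 0 < δ := by rw [hδ]; linarith
  set c : ℝ := Real.pi / (2 * L) with hc
  have hc0 : 0 < c := by have := Real.pi_pos; positivity
  have hy : ∀ m : ℤ, Real.pi * m / (2 * L) = c * m := fun m => by rw [hc]; ring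
  -- For `|m| > M` the height `c|m|` exceeds `Y` and also `|Im s| / 2`, so no pole of the numerator
  -- Gamma factor meets the ball.
  obtain ⟨M, hM⟩ := exists_nat_ge ((|Y| + ‖s₀‖ + 2) / c)
  rw [div_le_iff₀ hc0] at hM
  refine ⟨(Finset.Icc (-M : ℤ) M).subtype (· ≠ 0), Metric.ball s₀ (min 1 δ),
    fun m => |C| * (c * |(m : ℝ)|) ^ (-(1 + δ)), Metric.isOpen_ball,
    Metric.mem_ball_self (by positivity), ?_, ?_⟩
  · refine Summable.mul_left _ ?_
    have h := ((Real.summable_abs_int_rpow (b := 1 + δ) (by linarith)).mul_left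
      (c ^ (-(1 + δ)))).subtype {m : ℤ | m ≠ 0}
    exact h.congr fun m => by rw [Real.mul_rpow hc0.le (abs_nonneg _)]; rfl
  have hbig : ∀ m ∉ (Finset.Icc (-M : ℤ) M).subtype (· ≠ 0),
      |Y| + ‖s₀‖ + 2 ≤ |c * ((m : ℤ) : ℝ)| := by
    intro m hm
    rw [Finset.mem_subtype, Finset.mem_Icc, ← abs_le, not_le] at hm
    have : (M : ℝ) ≤ |((m : ℤ) : ℝ)| := by exact_mod_cast hm.le
    rw [abs_mul, abs_of_pos hc0]
    nlinarith
  have hball : ∀ s ∈ Metric.ball s₀ (min 1 δ), ‖s‖ ≤ ‖s₀‖ + 1 ∧ s.re ≤ 2 - δ := by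
    intro s hs
    rw [Metric.mem_ball, dist_eq_norm, lt_min_iff] at hs
    refine ⟨by linarith [norm_le_norm_add_norm_sub' s s₀], ?_⟩
    have := Complex.re_le_norm (s - s₀)
    rw [Complex.sub_re] at this
    rw [hδ] at hs ⊢
    linarith
  refine ⟨fun m hm s hs => (AnalyticAt.differentiableAt ?_).differentiableWithinAt,
    fun m hm s hs => ?_⟩
  · refine analyticAt_gammaDefect he m.2 fun k h => ?_
    rw [← hLe, hy] at h
    have h1 : s.im / 2 = c * (m : ℤ) := by
      have := congrArg Complex.im h
      rw [Complex.sub_im, mul_comm, Complex.im_ofReal_mul] at this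
      simp at this
      linarith
    have h2 := hbig m hm
    rw [← h1, abs_div, abs_two] at h2
    linarith [Complex.abs_im_le_norm s, (hball s hs).1, abs_nonneg Y, norm_nonneg s₀]
  · have h2 := hbig m hm
    have h3 : 1 ≤ |c * ((m : ℤ) : ℝ)| := by linarith [abs_nonneg Y, norm_nonneg s₀]
    have key := hCY s (hball s hs).1 (c * (m : ℤ))
      (by linarith [le_abs_self Y, norm_nonneg s₀])
    have hne := neg_I_mul_ne_zero he m.2
    rw [← hLe, hy] at hne
    rw [gammaDefect, gammaRatio_eq, ← hLe, hy, ← div_eq_mul_inv, Complex.cpow_def_of_ne_zero hne,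
      mul_comm (Complex.log _)]
    refine key.trans ?_
    beta_reduce
    rw [show c * |((m : ℤ) : ℝ)| = |c * ((m : ℤ) : ℝ)| by rw [abs_mul, abs_of_pos hc0]]
    calc _ ≤ |C| * |c * ((m : ℤ) : ℝ)| ^ (s.re - 3) := by
          gcongr
          exact le_abs_self C
      _ ≤ _ := by
          refine mul_le_mul_of_nonneg_left ?_ (abs_nonneg C)
          exact Real.rpow_le_rpow_of_exponent_le h3 (by linarith [(hball s hs).2])

theorem exists_tsum_gammaDefect_eq {e : ℝ} (he : 1 < e) {s₀ : ℂ} (hs₀ : s₀.re < 2) :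
    ∃ (T : Finset {m : ℤ // m ≠ 0}) (g : ℂ → ℂ), AnalyticAt ℂ g s₀ ∧ ∀ᶠ s in 𝓝 s₀,
      Summable (fun m : {m : ℤ // m ≠ 0} => gammaDefect e m s) ∧
      ∑' m : {m : ℤ // m ≠ 0}, gammaDefect e m s = ∑ m ∈ T, gammaDefect e m s + g s := by
  obtain ⟨T, U, u, hU, hsU, hu, hd, hb⟩ := exists_tail_bound_gammaDefect he hs₀
  obtain ⟨g, hg, h⟩ := exists_analyticAt_tsum_eq (f := fun m : {m : ℤ // m ≠ 0} => gammaDefect e m)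
    T hU hsU hu hd hb
  exact ⟨T, g, hg, by filter_upwards [hU.mem_nhds hsU] with s hs using h s hs⟩

theorem summable_gammaDefect {e : ℝ} (he : 1 < e) {s : ℂ} (hs : s.re < 2) :
    Summable (fun m : {m : ℤ // m ≠ 0} => gammaDefect e m s) := by
  obtain ⟨T, g, -, h⟩ := exists_tsum_gammaDefect_eq he hs
  exact h.self_of_nhds.1

theorem meromorphicAt_tsum_gammaDefect {e : ℝ} (he : 1 < e) {s : ℂ} (hs : s.re < 2) :
    MeromorphicAt (fun s => ∑' m : {m : ℤ // m ≠ 0}, gammaDefect e m s) s := by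
  obtain ⟨T, g, hg, h⟩ := exists_tsum_gammaDefect_eq he hs
  refine MeromorphicAt.congr (f := fun s => ∑ m ∈ T, gammaDefect e m s + g s) ?_ ?_
  · exact (MeromorphicAt.fun_sum fun m _ => meromorphicAt_gammaDefect he m.2 s).fun_add
      hg.meromorphicAt
  · exact EventuallyEq.filter_mono (EventuallyEq.symm (h.mono fun _ h => h.2)) nhdsWithin_le_nhds

theorem analyticAt_tsum_gammaDefect {e : ℝ} (he : 1 < e) {s : ℂ} (hs : s.re < 2)
    (hP : s ∉ poleSet e) :
    AnalyticAt ℂ (fun s => ∑' m : {m : ℤ // m ≠ 0}, gammaDefect e m s) s := by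
  obtain ⟨T, g, hg, h⟩ := exists_tsum_gammaDefect_eq he hs
  refine AnalyticAt.congr (f := fun s => ∑ m ∈ T, gammaDefect e m s + g s) ?_
    (EventuallyEq.symm (h.mono fun _ h => h.2))
  exact (Finset.analyticAt_fun_sum T fun (m : {m : ℤ // m ≠ 0}) _ =>
    analyticAt_gammaDefect he m.2 (half_sub_ne_of_notMem_poleSet he hP m)).fun_add hg

theorem neg_I_mul_cpow {y : ℝ} (hy : y ≠ 0) (w : ℂ) :
    (-Complex.I * y) ^ w =
      Complex.exp (w * (Real.log |y| - Real.pi / 2 * Complex.I * (SignType.sign y : ℤ))) := by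
  have hne : -Complex.I * (y : ℂ) ≠ 0 :=
    mul_ne_zero (neg_ne_zero.2 Complex.I_ne_zero) (by exact_mod_cast hy)
  rw [Complex.cpow_def_of_ne_zero hne, mul_comm]
  congr 2
  rcases hy.lt_or_gt with h | h
  · rw [show -Complex.I * (y : ℂ) = ((|y| : ℝ) : ℂ) * Complex.I by
        rw [abs_of_neg h]; push_cast; ring,
      Complex.log_ofReal_mul (abs_pos.2 hy) Complex.I_ne_zero, Complex.log_I, sign_neg h]
    simp
  · rw [show -Complex.I * (y : ℂ) = ((|y| : ℝ) : ℂ) * (-Complex.I) by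
        rw [abs_of_pos h]; ring,
      Complex.log_ofReal_mul (abs_pos.2 hy) (neg_ne_zero.2 Complex.I_ne_zero), Complex.log_neg_I,
      sign_pos h]
    simp
    ring

/-- Since `π|m| / (2L) = 2π|m| / (4L)` and `arg (-iy) = -(π/2) sgn y`, the subtracted exponential is
the leading term `(-iy)^{s-1}` in polar form. -/
theorem poissonTerm_eq {e : ℝ} (he : 1 < e) (s : ℂ) {m : ℤ} (hm : m ≠ 0) :
    poissonTerm e s m = Complex.Gamma (1 - s) / (4 * Real.log e) * gammaDefect e m s := by
  have hL := Real.log_pos he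
  have hm' : (m : ℝ) ≠ 0 := by exact_mod_cast hm
  have hpi := Real.pi_pos
  have hmabs : 0 < |(m : ℝ)| := abs_pos.2 hm'
  set L := Real.log e with hLe
  have hL' : (L : ℂ) ≠ 0 := by exact_mod_cast hL.ne'
  have hy0 : Real.pi * m / (2 * L) ≠ 0 := by positivity
  have hsgn : (SignType.sign (Real.pi * m / (2 * L)) : ℤ) = m.sign := by
    rcases hm.lt_or_gt with h | h
    · have h1 : (m : ℝ) < 0 := by exact_mod_cast h
      rw [Int.sign_eq_neg_one_of_neg h, sign_neg (div_neg_of_neg_of_pos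
        (mul_neg_of_pos_of_neg hpi h1) (by positivity))]
      rfl
    · have h1 : (0 : ℝ) < m := by exact_mod_cast h
      rw [Int.sign_eq_one_of_pos h, sign_pos (by positivity)]
      rfl
  have habs : Real.log |Real.pi * m / (2 * L)| = Real.log (2 * Real.pi * |(m : ℝ)|) -
      Real.log (4 * L) := by
    rw [← Real.log_div (by positivity) (by positivity), abs_div, abs_mul, abs_of_pos hpi,
      abs_of_pos (by positivity : 0 < 2 * L)]
    congr 1
    field_simp
    ring
  have h4L : (4 * L : ℂ) = Complex.exp (Real.log (4 * L)) := by
    rw [← Complex.ofReal_exp, Real.exp_log (by positivity)]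
    push_cast; rfl
  have key : Complex.exp (Real.pi * Complex.I / 2 * (1 - s) * (m.sign : ℂ)) /
      (((2 * Real.pi * |(m : ℝ)| : ℝ) : ℂ) ^ (1 - s) * ((4 * L : ℝ) : ℂ) ^ s) =
      Complex.exp ((s - 1) * (((Real.log (2 * Real.pi * |(m : ℝ)|) - Real.log (4 * L) : ℝ) : ℂ) -
        Real.pi / 2 * Complex.I * m.sign)) / (4 * L) := by
    rw [Complex.cpow_def_of_ne_zero
        (by exact_mod_cast (by positivity : 2 * Real.pi * |(m : ℝ)| ≠ 0)),
      Complex.cpow_def_of_ne_zero (by exact_mod_cast (by positivity : 4 * L ≠ 0)),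
      ← Complex.ofReal_log (by positivity), ← Complex.ofReal_log (by positivity), h4L,
      ← Complex.exp_add, ← Complex.exp_sub, ← Complex.exp_sub]
    congr 1
    push_cast
    ring
  rw [poissonTerm, gammaDefect, ← hLe, neg_I_mul_cpow hy0, hsgn, habs, mul_div_assoc,
    mul_div_assoc _ (Complex.exp _), key]
  ring

/-! ### Comparison of the two expansions -/

theorem hasSum_one_div_nat_add_one_cpow {w : ℂ} (hw : 1 < w.re) :
    HasSum (fun n : ℕ => 1 / (n + 1 : ℂ) ^ w) (riemannZeta w) := by
  rw [zeta_eq_tsum_one_div_nat_add_one_cpow hw]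
  have h := (summable_nat_add_iff 1).2 (Complex.summable_one_div_nat_cpow.2 hw)
  push_cast at h
  exact h.hasSum

/-- The terms for `m` and `-m` carry the phases `e^{±iπ(1-s)/2}`, which add to the cosine; the `m =
0` term is `0 ^ (s - 1) = 0`. -/
theorem hasSum_neg_I_mul_cpow {c : ℝ} (hc : 0 < c) {s : ℂ} (hs : s.re < 0) :
    HasSum (fun m : ℤ => (-Complex.I * (c * m : ℝ)) ^ (s - 1))
      ((c : ℂ) ^ (s - 1) * (2 * Complex.cos (Real.pi * (1 - s) / 2)) * riemannZeta (1 - s)) := by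
  have hz := hasSum_one_div_nat_add_one_cpow (w := 1 - s) (by simp; linarith)
  have hc' : (c : ℂ) ≠ 0 := by exact_mod_cast hc.ne'
  have hlog : ∀ n : ℕ, Complex.exp ((s - 1) * Real.log (c * (n + 1))) =
      (c : ℂ) ^ (s - 1) * (1 / (n + 1 : ℂ) ^ (1 - s)) := by
    intro n
    have hn : (0 : ℝ) < n + 1 := by positivity
    have hn' : ((n : ℂ) + 1) = ((n + 1 : ℝ) : ℂ) := by push_cast; rfl
    rw [Real.log_mul hc.ne' hn.ne', one_div, ← Complex.cpow_neg, hn',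
      Complex.cpow_def_of_ne_zero hc', Complex.cpow_def_of_ne_zero (by exact_mod_cast hn.ne'),
      ← Complex.ofReal_log hc.le, ← Complex.ofReal_log hn.le, ← Complex.exp_add]
    congr 1
    push_cast
    ring
  have hpos : ∀ n : ℕ, (-Complex.I * (c * ((n + 1 : ℤ) : ℝ) : ℝ)) ^ (s - 1) =
      (c : ℂ) ^ (s - 1) * Complex.exp (Real.pi * (1 - s) / 2 * Complex.I) *
        (1 / (n + 1 : ℂ) ^ (1 - s)) := by
    intro n
    have hn : (0 : ℝ) < c * ((n + 1 : ℤ) : ℝ) := by push_cast; positivity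
    rw [neg_I_mul_cpow hn.ne', abs_of_pos hn, sign_pos hn, mul_sub, Complex.exp_sub,
      mul_right_comm ((c : ℂ) ^ (s - 1)), div_eq_mul_inv, ← Complex.exp_neg]
    rw [← hlog]
    push_cast
    congr 2
    simp
    ring
  have hneg : ∀ n : ℕ, (-Complex.I * (c * ((-(n + 1 : ℤ) : ℤ) : ℝ) : ℝ)) ^ (s - 1) =
      (c : ℂ) ^ (s - 1) * Complex.exp (-(Real.pi * (1 - s) / 2) * Complex.I) *
        (1 / (n + 1 : ℂ) ^ (1 - s)) := by
    intro n
    have hn : c * ((-(n + 1 : ℤ) : ℤ) : ℝ) < 0 := by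
      push_cast
      have : 0 < c * (n + 1) := by positivity
      linarith
    rw [neg_I_mul_cpow hn.ne, abs_of_neg hn, sign_neg hn, mul_sub, Complex.exp_sub,
      mul_right_comm ((c : ℂ) ^ (s - 1)), div_eq_mul_inv, ← Complex.exp_neg, ← hlog]
    congr 2
    · push_cast
      ring_nf
    · simp
      ring
  have h := HasSum.of_add_one_of_neg_add_one
    (f := fun m : ℤ => (-Complex.I * (c * m : ℝ)) ^ (s - 1))
    ((hz.mul_left _).congr_fun hpos) ((hz.mul_left _).congr_fun hneg)
  have h0 : (-Complex.I * (c * ((0 : ℤ) : ℝ) : ℝ)) ^ (s - 1) = 0 := by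
    have : s - 1 ≠ 0 := by
      intro h
      have := congrArg Complex.re h
      simp at this
      linarith
    simp [Complex.zero_cpow this]
  beta_reduce at h
  rw [h0, add_zero] at h
  refine (congrArg (HasSum _ · _) ?_).mpr h
  rw [Complex.two_cos]
  ring

/-- The functional equation of `ζ` read at `1 - s`. -/
theorem Gamma_mul_leading_eq_zeta {L : ℝ} (hL : 0 < L) {s : ℂ} (hs : s.re < 0) :
    Complex.Gamma (1 - s) / (4 * L) * (((Real.pi / (2 * L) : ℝ) : ℂ) ^ (s - 1) *
      (2 * Complex.cos (Real.pi * (1 - s) / 2)) * riemannZeta (1 - s)) =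
      riemannZeta s / ((4 * L : ℝ) : ℂ) ^ s := by
  have hpi := Real.pi_pos
  have hfe := riemannZeta_one_sub (s := 1 - s) (fun n h => by
    have := congrArg Complex.re h
    simp at this
    linarith [Nat.cast_nonneg (α := ℝ) n]) (fun h => by
    have := congrArg Complex.re h
    simp at this
    linarith)
  rw [sub_sub_cancel] at hfe
  have h4L : (4 * L : ℂ) = Complex.exp (Real.log (4 * L)) := by
    rw [← Complex.ofReal_exp, Real.exp_log (by positivity)]
    push_cast; rfl
  have key : ((Real.pi / (2 * L) : ℝ) : ℂ) ^ (s - 1) / (4 * L) =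
      (2 * Real.pi : ℂ) ^ (-(1 - s)) / ((4 * L : ℝ) : ℂ) ^ s := by
    have e : (2 * Real.pi : ℂ) = ((2 * Real.pi : ℝ) : ℂ) := by push_cast; rfl
    have elog : Real.log (Real.pi / (2 * L)) = Real.log (2 * Real.pi) - Real.log (4 * L) := by
      rw [← Real.log_div (by positivity) (by positivity)]
      congr 1
      field_simp
      ring
    rw [e, Complex.cpow_def_of_ne_zero (by exact_mod_cast (by positivity : Real.pi / (2 * L) ≠ 0)),
      Complex.cpow_def_of_ne_zero (by exact_mod_cast (by positivity : 2 * Real.pi ≠ 0)),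
      Complex.cpow_def_of_ne_zero (by exact_mod_cast (by positivity : 4 * L ≠ 0)),
      ← Complex.ofReal_log (by positivity), ← Complex.ofReal_log (by positivity),
      ← Complex.ofReal_log (by positivity), elog, h4L, ← Complex.exp_sub, ← Complex.exp_sub]
    congr 1
    push_cast
    ring
  rw [hfe]
  linear_combination Complex.Gamma (1 - s) * 2 * Complex.cos (Real.pi * (1 - s) / 2) *
    riemannZeta (1 - s) * key

theorem hasSum_neg_I_mul_log_cpow {e : ℝ} (he : 1 < e) {s : ℂ} (hs : s.re < 0) :
    HasSum (fun m : ℤ => (-Complex.I * (Real.pi * m / (2 * Real.log e) : ℝ)) ^ (s - 1))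
      (((Real.pi / (2 * Real.log e) : ℝ) : ℂ) ^ (s - 1) *
        (2 * Complex.cos (Real.pi * (1 - s) / 2)) * riemannZeta (1 - s)) := by
  have hL := Real.log_pos he
  have hc : 0 < Real.pi / (2 * Real.log e) := by have := Real.pi_pos; positivity
  refine (hasSum_neg_I_mul_cpow hc hs).congr_fun fun m => ?_
  rw [div_mul_eq_mul_div]

theorem hasSum_int_of_hasSum_ne_zero {f : ℤ → ℂ} {a : ℂ}
    (h : HasSum (fun m : {m : ℤ // m ≠ 0} => f m) a) : HasSum f (a + f 0) := by
  have h0 : HasSum (f ∘ ((↑) : ({0} : Set ℤ) → ℤ)) (f 0) := by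
    have := hasSum_unique (f ∘ ((↑) : ({0} : Set ℤ) → ℤ))
    simpa using this
  rw [add_comm]
  exact h0.add_compl h

theorem hasSum_gammaDefect_int {e : ℝ} (he : 1 < e) {s : ℂ} (hs : s.re < 0) :
    HasSum (fun m : ℤ => gammaDefect e m s)
      (∑' m : {m : ℤ // m ≠ 0}, gammaDefect e m s + gammaRatio e s 0) := by
  have h := hasSum_int_of_hasSum_ne_zero (f := fun m => gammaDefect e m s)
    (summable_gammaDefect he (by linarith)).hasSum
  -- By the convention `0 ^ (s - 1) = 0` nothing is subtracted at `m = 0`.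
  have h0 : gammaDefect e 0 s = gammaRatio e s 0 := by
    have : s - 1 ≠ 0 := by
      intro h
      have := congrArg Complex.re h
      simp at this
      linarith
    simp [gammaDefect, Complex.zero_cpow this]
  rwa [h0] at h

theorem summable_gammaRatio {e : ℝ} (he : 1 < e) {s : ℂ} (hs : s.re < 0) :
    Summable (fun m : ℤ => gammaRatio e s m) := by
  refine ((hasSum_gammaDefect_int he hs).summable.add
    (hasSum_neg_I_mul_log_cpow he hs).summable).congr fun m => ?_
  rw [gammaDefect]
  ring

theorem sinhZeta_eq_tsum_gammaRatio {e : ℝ} (he : 1 < e) {s : ℂ} (hs : s.re < 0)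
    (hP : s ∉ poleSet e) :
    sinhZeta (Real.log e) s =
      Complex.Gamma (1 - s) / (4 * Real.log e) * ∑' m : ℤ, gammaRatio e s m := by
  have h := summable_gammaRatio he hs
  have h1 : Summable fun n : ℕ => gammaRatio e s (n + 1) :=
    h.comp_injective (i := fun n : ℕ => (n + 1 : ℤ)) fun a b hab => by
      simpa using hab
  have h2 : Summable fun n : ℕ => gammaRatio e s (-(n + 1)) :=
    h.comp_injective (i := fun n : ℕ => -(n + 1 : ℤ)) fun a b hab => by
      simpa using hab
  have h3 := (hasSum_gammaRatio_pair he hs hP).tsum_eq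
  rw [tsum_mul_left, h1.tsum_add h2] at h3
  rw [tsum_of_add_one_of_neg_add_one h1 h2]
  linear_combination -h3

/-- The expansion of `sinhZeta` that is valid in the half-plane `re s < 2`. -/
noncomputable def poissonExpansion (e : ℝ) (s : ℂ) : ℂ :=
  riemannZeta s / ((4 * Real.log e : ℝ) : ℂ) ^ s +
    Complex.Gamma (1 - s) / (4 * Real.log e) *
      (gammaRatio e s 0 + ∑' m : {m : ℤ // m ≠ 0}, gammaDefect e m s)

theorem sinhZeta_eq_poissonExpansion_of_re_neg {e : ℝ} (he : 1 < e) {s : ℂ} (hs : s.re < 0)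
    (hP : s ∉ poleSet e) : sinhZeta (Real.log e) s = poissonExpansion e s := by
  have hlead := hasSum_neg_I_mul_log_cpow he hs
  have h1 := (hasSum_gammaDefect_int he hs).add hlead
  have h2 : ∑' m : ℤ, gammaRatio e s m = _ := (h1.congr_fun fun m => by
    rw [gammaDefect, sub_add_cancel]).tsum_eq
  rw [sinhZeta_eq_tsum_gammaRatio he hs hP, h2, poissonExpansion,
    ← Gamma_mul_leading_eq_zeta (Real.log_pos he) hs]
  ring

/-- At `1` the product `(z - 1) ζ(z)` has a removable singularity, by the residue limit. -/
theorem meromorphicAt_riemannZeta (s : ℂ) : MeromorphicAt riemannZeta s := by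
  rcases eq_or_ne s 1 with rfl | hs
  · set g : ℂ → ℂ := Function.update (fun z => (z - 1) * riemannZeta z) 1 1
    have hg : ∀ z ≠ 1, g z = (z - 1) * riemannZeta z := fun z hz => Function.update_of_ne hz _ _
    have han : AnalyticAt ℂ g 1 := by
      refine Complex.analyticAt_of_differentiable_on_punctured_nhds_of_continuousAt ?_ ?_
      · filter_upwards [self_mem_nhdsWithin] with z hz
        refine DifferentiableAt.congr_of_eventuallyEq (f := fun z => (z - 1) * riemannZeta z)
          (DifferentiableAt.fun_mul (by fun_prop) (differentiableAt_riemannZeta hz)) ?_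
        filter_upwards [isOpen_compl_singleton.mem_nhds hz] with w hw using hg w hw
      · rw [continuousAt_update_same]
        exact riemannZeta_residue_one
    refine (han.meromorphicAt.fun_div (g := fun z : ℂ => z - 1) (by fun_prop)).congr ?_
    filter_upwards [self_mem_nhdsWithin] with z hz
    rw [hg z hz, mul_div_cancel_left₀ _ (sub_ne_zero.2 hz)]
  · exact (analyticOn_riemannZeta s hs).meromorphicAt

theorem meromorphicAt_poissonExpansion {e : ℝ} (he : 1 < e) {s : ℂ} (hs : s.re < 2) :
    MeromorphicAt (poissonExpansion e) s := by
  have h4 : ((4 * Real.log e : ℝ) : ℂ) ≠ 0 := by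
    have := Real.log_pos he
    exact_mod_cast (by positivity : 4 * Real.log e ≠ 0)
  refine MeromorphicAt.fun_add (MeromorphicAt.fun_div (meromorphicAt_riemannZeta s)
    (analyticAt_const_cpow h4 analyticAt_id).meromorphicAt) (MeromorphicAt.fun_mul
      (MeromorphicAt.fun_div ?_ (MeromorphicAt.const _ _)) (MeromorphicAt.fun_add
        (meromorphicAt_gammaRatio e 0 s) (meromorphicAt_tsum_gammaDefect he hs)))
  exact (Meromorphic.Gamma _).comp_analyticAt (g := fun s : ℂ => 1 - s) (by fun_prop)

theorem analyticAt_poissonExpansion {e : ℝ} (he : 1 < e) {s : ℂ} (hs : s.re < 2) (hs1 : s ≠ 1)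
    (hP : s ∉ poleSet e) : AnalyticAt ℂ (poissonExpansion e) s := by
  have h4 : ((4 * Real.log e : ℝ) : ℂ) ≠ 0 := by
    have := Real.log_pos he
    exact_mod_cast (by positivity : 4 * Real.log e ≠ 0)
  have h4' : (4 * Real.log e : ℂ) ≠ 0 := by exact_mod_cast h4
  refine AnalyticAt.fun_add (AnalyticAt.fun_div (analyticOn_riemannZeta s hs1)
    (analyticAt_const_cpow h4 analyticAt_id) (fun h => h4 (Complex.cpow_eq_zero_iff _ _ |>.1 h).1))
    (AnalyticAt.fun_mul (AnalyticAt.fun_div ?_ analyticAt_const h4') (AnalyticAt.fun_add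
        (analyticAt_gammaRatio (half_sub_ne_of_notMem_poleSet he hP 0))
        (analyticAt_tsum_gammaDefect he hs hP)))
  -- The poles `1, 2, 3, …` of `Γ(1 - s)` meet `Re s < 2` only at the excluded point `1`.
  refine (analyticAt_Gamma fun k h => ?_).fun_comp (f := fun s : ℂ => 1 - s) (by fun_prop)
  have hk : s = k + 1 := by linear_combination -h
  rcases k with _ | k
  · simp at hk
    exact hs1 hk
  · rw [hk] at hs
    simp at hs
    linarith [Nat.cast_nonneg (α := ℝ) k]

theorem re_of_mem_poleSet {e : ℝ} {s : ℂ} (hs : s ∈ poleSet e) : ∃ k : ℕ, s.re = -2 * k := by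
  obtain ⟨m, k, rfl⟩ := hs
  refine ⟨k, ?_⟩
  have : (Real.pi * Complex.I * m / Real.log e : ℂ) =
      ((Real.pi * m / Real.log e : ℝ) : ℂ) * Complex.I := by
    push_cast; ring
  rw [this, Complex.sub_re, Complex.re_ofReal_mul]
  simp

/-- Identity theorem for meromorphic functions on a convex half-plane. The base point `-1` lies in
the pole-free strip `-2 < Re s < 0`, where the formula is known. -/
theorem sinhZeta_eq_poissonExpansion {e : ℝ} (he : 1 < e) {s : ℂ} (hs : s.re < 2) (hs1 : s ≠ 1)
    (hP : s ∉ poleSet e) : sinhZeta (Real.log e) s = poissonExpansion e s := by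
  have hL := Real.log_pos he
  set U : Set ℂ := {z | z.re < 2}
  have hmer : MeromorphicOn (sinhZeta (Real.log e) - poissonExpansion e) U := fun z hz =>
    (meromorphic_sinhZeta hL z).sub (meromorphicAt_poissonExpansion he hz)
  have hU : IsPreconnected U := (convex_halfSpace_re_lt 2).isPreconnected
  have hneg : meromorphicOrderAt (sinhZeta (Real.log e) - poissonExpansion e) (-1) = ⊤ := by
    rw [meromorphicOrderAt_eq_top_iff]
    refine Filter.Eventually.filter_mono nhdsWithin_le_nhds ?_
    have h1 : ∀ᶠ z : ℂ in 𝓝 (-1), z.re < 0 :=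
      Complex.continuous_re.continuousAt.eventually_lt_const (by simp)
    have h2 : ∀ᶠ z : ℂ in 𝓝 (-1), -2 < z.re :=
      Complex.continuous_re.continuousAt.eventually_const_lt (by simp)
    filter_upwards [h1, h2] with z hz1 hz2
    rw [Pi.sub_apply, sub_eq_zero]
    refine sinhZeta_eq_poissonExpansion_of_re_neg he hz1 fun hz => ?_
    obtain ⟨k, hk⟩ := re_of_mem_poleSet hz
    rcases k with _ | k
    · simp at hk
      linarith
    · push_cast at hk
      linarith [Nat.cast_nonneg (α := ℝ) k]
  have htop : meromorphicOrderAt (sinhZeta (Real.log e) - poissonExpansion e) s = ⊤ := by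
    by_contra h
    exact hmer.meromorphicOrderAt_ne_top_of_isPreconnected hU (x := s) (y := -1) hs
      (show (-1 : ℂ).re < 2 by simp; norm_num) h hneg
  rw [meromorphicOrderAt_eq_top_iff] at htop
  -- Infinite order gives equality only on a punctured neighbourhood; analyticity carries it to `s`
  -- itself.
  have han : AnalyticAt ℂ (sinhZeta (Real.log e) - poissonExpansion e) s :=
    (analyticAt_sinhZeta hL (exp_ne_one_of_notMem_poleSet he hP)).sub
      (analyticAt_poissonExpansion he hs hs1 hP)
  have h0 := (han.frequently_zero_iff_eventually_zero.1 htop.frequently).self_of_nhds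
  exact sub_eq_zero.1 h0

end FibZeta

/-! ### Assembly of the main theorem -/

theorem theorem4p4 (D : ℕ) (hD : Squarefree D) (hD1 : 1 < D)
    (ε : (NumberField.RingOfIntegers (FibZeta.QuadField D))ˣ)
    (hε : FibZeta.IsFundamentalUnit ε) :
    ∃ Z : ℂ → ℂ,
      -- `Z` is a meromorphic function on the whole plane
      Meromorphic Z ∧
      -- for `Re s > 0` it is the sum of the (absolutely convergent) defining series
      (∀ s : ℂ, 0 < s.re →
        HasSum (fun n : ℕ => 1 / (FibZeta.fib ε (2 * (n + 1)) : ℂ) ^ s) (Z s)) ∧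
      (∀ s : ℂ, 0 < s.re →
        Summable (fun n : ℕ => ((FibZeta.unitToReal ε ^ (2 * (n + 1)) -
          (FibZeta.unitToReal ε ^ (2 * (n + 1)))⁻¹ : ℝ) : ℂ) ^ (-s)) ∧
        Z s = (FibZeta.q D : ℂ) ^ (s / 2) *
          ∑' n : ℕ, ((FibZeta.unitToReal ε ^ (2 * (n + 1)) -
            (FibZeta.unitToReal ε ^ (2 * (n + 1)))⁻¹ : ℝ) : ℂ) ^ (-s)) ∧
      -- the expression valid for `Re s < 2`, away from the poles of its terms
      (∀ s : ℂ, s.re < 2 → s ≠ 1 → s ∉ FibZeta.poleSet (FibZeta.unitToReal ε) →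
        Summable (fun m : {m : ℤ // m ≠ 0} =>
          FibZeta.poissonTerm (FibZeta.unitToReal ε) s m) ∧
        Z s =
          (FibZeta.q D : ℂ) ^ (s / 2) * riemannZeta s /
              (4 * Real.log (FibZeta.unitToReal ε) : ℝ) ^ s +
            (FibZeta.q D : ℂ) ^ (s / 2) * Complex.Gamma (1 - s) * Complex.Gamma (s / 2) /
              (4 * Complex.Gamma (1 - s / 2) * Real.log (FibZeta.unitToReal ε)) +
            (FibZeta.q D : ℂ) ^ (s / 2) * ∑' m : {m : ℤ // m ≠ 0},
              FibZeta.poissonTerm (FibZeta.unitToReal ε) s m) ∧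
      -- the simpler expression valid for `Re s < 0`
      (∀ s : ℂ, s.re < 0 → s ∉ FibZeta.poleSet (FibZeta.unitToReal ε) →
        Summable (fun m : ℤ => FibZeta.gammaRatio (FibZeta.unitToReal ε) s m) ∧
        Z s =
          (FibZeta.q D : ℂ) ^ (s / 2) * Complex.Gamma (1 - s) /
              (4 * Real.log (FibZeta.unitToReal ε)) *
            ∑' m : ℤ, FibZeta.gammaRatio (FibZeta.unitToReal ε) s m) ∧
      -- simple poles exactly on the half-lattice
      (∀ s ∈ FibZeta.poleSet (FibZeta.unitToReal ε), meromorphicOrderAt Z s = -1) ∧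
      (∀ s ∉ FibZeta.poleSet (FibZeta.unitToReal ε), AnalyticAt ℂ Z s) := by
  obtain ⟨he, -⟩ := hε
  set e := FibZeta.unitToReal ε
  have hL := Real.log_pos he
  have hq : (FibZeta.q D : ℂ) ≠ 0 := by
    have : FibZeta.q D ≠ 0 := by unfold FibZeta.q; split_ifs <;> omega
    exact_mod_cast this
  have hqa : ∀ s : ℂ, AnalyticAt ℂ (fun s : ℂ => (FibZeta.q D : ℂ) ^ (s / 2)) s := fun s =>
    FibZeta.analyticAt_const_cpow hq (by fun_prop)
  have hq0 : ∀ s : ℂ, (FibZeta.q D : ℂ) ^ (s / 2) ≠ 0 := fun s h =>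
    hq ((Complex.cpow_eq_zero_iff _ _).1 h).1
  have hser : ∀ s : ℂ, 0 < s.re → HasSum (fun n : ℕ =>
      ((e ^ (2 * (n + 1)) - (e ^ (2 * (n + 1)))⁻¹ : ℝ) : ℂ) ^ (-s))
      (FibZeta.sinhZeta (Real.log e) s) := by
    intro s hs
    refine (FibZeta.hasSum_sinhZeta hL hs).congr_fun fun n => ?_
    have : Real.exp (2 * (n + 1) * Real.log e) = e ^ (2 * (n + 1)) := by
      rw [← Real.exp_log (zero_lt_one.trans he), Real.log_exp, ← Real.exp_nat_mul]
      push_cast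
      rfl
    rw [this]
  -- The factor `q^{s/2}` is entire without zeros, so orders and poles are those of `sinhZeta`.
  refine ⟨(fun s => (FibZeta.q D : ℂ) ^ (s / 2)) * FibZeta.sinhZeta (Real.log e), fun s =>
    (hqa s).meromorphicAt.mul (FibZeta.meromorphic_sinhZeta hL s), fun s hs => ?_,
    fun s hs => ⟨(hser s hs).summable, ?_⟩, fun s hs hs1 hP => ⟨?_, ?_⟩,
    fun s hs hP => ⟨FibZeta.summable_gammaRatio he hs, ?_⟩, ?_, fun s hP => ?_⟩
  · exact ((hser s hs).mul_left _).congr_fun fun n => FibZeta.one_div_fib_cpow hD hD1 ε he n s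
  · rw [(hser s hs).tsum_eq, Pi.mul_apply]
  · exact ((FibZeta.summable_gammaDefect he hs).mul_left _).congr fun m =>
      (FibZeta.poissonTerm_eq he s m.2).symm
  · rw [Pi.mul_apply, FibZeta.sinhZeta_eq_poissonExpansion he hs hs1 hP, FibZeta.poissonExpansion,
      tsum_congr fun m : {m : ℤ // m ≠ 0} => FibZeta.poissonTerm_eq he s m.2, tsum_mul_left,
      FibZeta.gammaRatio]
    simp only [Int.cast_zero, mul_zero, zero_div, sub_zero]
    ring
  · rw [Pi.mul_apply, FibZeta.sinhZeta_eq_tsum_gammaRatio he hs hP]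
    ring
  · rintro s ⟨m, k, rfl⟩
    rw [meromorphicOrderAt_mul_of_ne_zero (hqa _) (hq0 _), FibZeta.meromorphicOrderAt_sinhZeta hL]
  · exact (hqa s).mul (FibZeta.analyticAt_sinhZeta hL
      (FibZeta.exp_ne_one_of_notMem_poleSet he hP))
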